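/- **Setting.** Let $\mathbb K$ be an algebraically closed field of characteristic $0$, $a\in\mathbb K\setminus\{0,-1\}$, and let $\mathfrak g=\mathfrak g_0\oplus\mathfrak g_1=D(2,1;a)$ be the $17$-dimensional contragredient Lie superalgebra over $\mathbb K$ with Cartan matrix $\begin{pmatrix}0&1&a\\-1&2&0\\-1&0&2\end{pmatrix}$ (first simple root odd), realized as $\mathfrak g_0=\mathfrak{sl}_2^{\oplus3}$, $\mathfrak g_1=\mathbb K^2\otimes\mathbb K^2\otimes\mathbb K^2$. Its Cartan subalgebra is $\mathfrak h$; its even roots are $\Delta_0=\{\pm2\varepsilon_i\}_{i=1,2,3}$ and its odd roots are $\Delta_1=\{\pm\varepsilon_1\pm\varepsilon_2\pm\varepsilon_3\}$, where the $\varepsilon_i$ are orthogonal with $(\varepsilon_1,\varepsilon_1)=-\frac{1+a}2$, $(\varepsilon_2,\varepsilon_2)=\frac12$, $(\varepsilon_3,\varepsilon_3)=\frac a2$. The positive roots are $2\varepsilon_i$ and $\varepsilon_1\pm\varepsilon_2\pm\varepsilon_3$; $\Delta=\Delta_0\sqcup\Delta_1$ and $\Delta_j^\pm$ is the set of positive,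 respectively negative, roots in $\Delta_j$. The coroots are $H_\alpha\in\mathfrak h$, with $H_{-\alpha}=-H_\alpha$, $(2\varepsilon_i)(H_{2\varepsilon_j})=2\delta_{ij}$, and $H_\gamma=-\sum_i(\varepsilon_i,\varepsilon_i)\gamma_iH_{2\varepsilon_i}$ for an odd root $\gamma=\sum_i\gamma_i\varepsilon_i$. Let $\mathbb Z[a]\subseteq\mathbb K$ be the subring generated by $a$ and $\mathbb Z_a\subseteq\mathbb K$ the subring generated by all $\binom zn$, $z\in\mathbb Z[a]$, $n\in\mathbb N$. Fix a Chevalley basis $\{H_1,H_2,H_3\}\sqcup\{X_\alpha\}_{\alpha\in\Delta}$ of $\mathfrak g$, i.e. a homogeneous basis such that: $H_1,H_2,H_3$ is a basis of $\mathfrak h$ and $\mathfrak h_{\mathbb Z[a]}:=\mathrm{Span}_{\mathbb Z[a]}(H_i)=\mathrm{Span}_{\mathbb Z[a]}(H_\alpha:\alpha\in\Delta)$; $[H_i,H_j]=0$ and $[H_i,X_\alpha]=\alpha(H_i)X_\alpha$; $[X_\alpha,X_{-\alpha}]=\sigma_\alpha H_\alpha$ with $\sigma_\alpha=-1$ if $\alpha\in\Delta_1^-$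 and $\sigma_\alpha=1$ otherwise; for $\alpha,\beta\in\Delta$ with $\alpha+\beta\ne0$, $[X_\alpha,X_\beta]=c_{\alpha,\beta}X_{\alpha+\beta}$, where this is $0$ if $\alpha+\beta\notin\Delta$, while if $\alpha+\beta\in\Delta$ then $c_{\alpha,\beta}=\pm(r+1)$ when $\alpha$ or $\beta$ is non-isotropic ($r$ being the largest integer with $\beta-r\alpha\in\Delta\cup\{0\}$) and $c_{\alpha,\beta}=\pm\beta(H_\alpha)$ when both are isotropic. The Kostant superalgebra $K$ is the $\mathbb Z_a$-subalgebra of $U(\mathfrak g)$ generated by the divided powers $X_\alpha^{(n)}=X_\alpha^n/n!$ ($\alpha\in\Delta_0$, $n\in\mathbb N$), the $X_\gamma$ ($\gamma\in\Delta_1$) and the $\binom Hn$ ($H\in\mathfrak h_{\mathbb Z[a]}$, $n\in\mathbb N$). Let $V$ be a finite-dimensional rational $\mathfrak g$-module, i.e. $V=\bigoplus_{\mu\in\mathfrak h^*}V_\mu$ and every weight $\mu$ of $V$ satisfies $\mu(H_i)\in\mathbb Z[a]$ for all $i$ and $\mu(H_\alpha)\in\mathbb Z$ for all $\alpha\in\Delta_0$.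 Let $M\subseteq V$ be an admissible lattice, i.e. the $\mathbb Z_a$-span of a $\mathbb K$-basis of $V$ that is stable under $K$. Let $\Bbbk$ be a commutative $\mathbb Z_a$-algebra in which $2$ and $3$ are non-zero and are not zero divisors, and let $A=A_0\oplus A_1$ be a commutative $\Bbbk$-superalgebra (i.e. $xy=(-1)^{|x||y|}yx$ for homogeneous $x,y$) without $2$- and $3$-torsion. Put $V_\Bbbk=\Bbbk\otimes_{\mathbb Z_a}M$ and $V_\Bbbk(A)=A\otimes_\Bbbk V_\Bbbk$, on which $c\otimes f$ acts with the Koszul sign. Inside $\mathrm{GL}(V_\Bbbk(A))$ consider * $x_\alpha(t)=\sum_{n\ge0}t^nX_\alpha^{(n)}$ for $\alpha\in\Delta_0$, $t\in A_0$, and $x_\gamma(\vartheta)=1+\vartheta X_\gamma$ for $\gamma\in\Delta_1$, $\vartheta\in A_1$; * for $H\in\mathrm{Span}_{\mathbb Z}(H_\alpha:\alpha\in\Delta_0)$ and $t$ a unit of $A_0$, the operator $h_H(t)$ acting on each weight space of weight $\mu$ as $t^{\mu(H)}$; * for $H\in\mathfrak h_{\mathbb Z[a]}$ and $\varphi\in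 P_a(A)$, the operator $h^{[a]}_H(\varphi)$ acting on each weight space of weight $\mu$ as $\varphi(\ell^{\mu(H)})$. Here $\ell^{z}=\sum_{n\ge0}\binom zn(\ell-1)^n\in\mathbb Z_a[[\ell-1]]$ for $z\in\mathbb Z[a]$, and $P_a(A)$ is the set of $\Bbbk$-algebra morphisms $\varphi:\Bbbk\otimes_{\mathbb Z_a}\mathbb Z_a[\{\ell^{\pm a^n}\}_{n\in\mathbb N}]\to A$ with values in $A_0$, the source being the scalar extension of the subalgebra of $\mathbb Z_a[[\ell-1]]$ generated by the $\ell^{\pm a^n}$. Let $G_0(A)$ be the subgroup generated by all $x_\alpha(t)$ with $\alpha\in\Delta_0$, all $h_H(t)$ and all $h_H^{[a]}(\varphi)$, and let $G(A)$ be the subgroup generated by $G_0(A)$ and all $x_\gamma(\vartheta)$ with $\gamma\in\Delta_1$. Let $G_1(A)$, $G_0^\pm(A)$, $G_1^\pm(A)$ and $G^\pm(A)$ be the sets of finite products of elements $x_\beta(u)$ ($u\in A_0$ if $\beta$ is even, $u\in A_1$ if $\beta$ is odd) with $\beta$ ranging over $\Delta_1$, $\Delta_0^\pm$, $\Delta_1^\pm$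 and $\Delta_0^\pm\cup\Delta_1^\pm$, respectively. For a total order $\gamma_1\prec\dots\prec\gamma_8$ of $\Delta_1$ let $G_1^<(A)=\{x_{\gamma_1}(\vartheta_1)\cdots x_{\gamma_8}(\vartheta_8):\vartheta_1,\dots,\vartheta_8\in A_1\}$. **Theorem.** For every such $A$ one has the equalities of sets (a) $G(A)=G_0(A)\,G_1(A)$ and $G(A)=G_1(A)\,G_0(A)$; (b) $G^\pm(A)=G_0^\pm(A)\,G_1^\pm(A)$ and $G^\pm(A)=G_1^\pm(A)\,G_0^\pm(A)$, for both signs; (c) for every total order on $\Delta_1$, $G(A)=G_0(A)\,G_1^<(A)$ and $G(A)=G_1^<(A)\,G_0(A)$. -/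

import Mathlib

noncomputable section

namespace SuperD21

/-- The Koszul sign `(-1)^(i*j)` for parities `i`, `j`. -/
def koszul (i j : ZMod 2) : ℤ := if i = 1 ∧ j = 1 then -1 else 1

/-- A Lie superalgebra: a `ℤ/2`-graded module with an even super-skew-symmetric bracket
satisfying the super Jacobi identity. -/
class LieSuperalgebra (K : Type*) [CommRing K] (L : Type*) [AddCommGroup L] [Module K L] where
  grading : ZMod 2 → Submodule K L
  isInternal : DirectSum.IsInternal grading
  bracket : L →ₗ[K] L →ₗ[K] L
  bracket_mem : ∀ {i j : ZMod 2} {x y : L}, x ∈ grading i → y ∈ grading j →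
    bracket x y ∈ grading (i + j)
  bracket_skew : ∀ {i j : ZMod 2} {x y : L}, x ∈ grading i → y ∈ grading j →
    bracket x y + koszul i j • bracket y x = 0
  jacobi : ∀ {i j l : ZMod 2} {x y z : L}, x ∈ grading i → y ∈ grading j → z ∈ grading l →
    koszul i l • bracket x (bracket y z) + koszul j i • bracket y (bracket z x) +
      koszul l j • bracket z (bracket x y) = 0

abbrev SL2 (K : Type*) [Field K] : Type _ := LieAlgebra.SpecialLinear.sl (Fin 2) K

/-- The underlying space of the Lie superalgebra `D(2,1;a)`, in its standard realization: the even
part is `𝔰𝔩₂ ⊕ 𝔰𝔩₂ ⊕ 𝔰𝔩₂`, the odd part is `K² ⊗ K² ⊗ K²`, written as the space of functions of three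
indices in `{0, 1}` (coordinates in the tensor products of standard basis vectors). -/
def D21 (K : Type*) [Field K] (_a : K) : Type _ := (Fin 3 → SL2 K) × ((Fin 3 → Fin 2) → K)

section Construction
variable {K : Type*} [Field K] (a : K)

instance : AddCommGroup (D21 K a) :=
  inferInstanceAs (AddCommGroup ((Fin 3 → SL2 K) × ((Fin 3 → Fin 2) → K)))

instance : Module K (D21 K a) :=
  inferInstanceAs (Module K ((Fin 3 → SL2 K) × ((Fin 3 → Fin 2) → K)))

/-- The scalars `(ε₁, ε₁) = -(1+a)/2`, `(ε₂, ε₂) = 1/2`, `(ε₃, ε₃) = a/2` (of sum zero). -/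
def epsNorm : Fin 3 → K := ![-(1 + a) / 2, 1 / 2, a / 2]

/-- The standard symplectic form on `K²`. -/
def omega : Matrix (Fin 2) (Fin 2) K := !![0, 1; -1, 0]

/-- The operator `z ↦ ω(e_q, z) e_p + ω(e_p, z) e_q` on `K²`. -/
def symOp (p q : Fin 2) : Matrix (Fin 2) (Fin 2) K :=
  Matrix.of fun r t => (if r = p then omega q t else 0) + (if r = q then omega p t else 0)

lemma symOp_trace (p q : Fin 2) : (symOp (K := K) p q).trace = 0 := by
  fin_cases p <;> fin_cases q <;> simp [symOp, omega, Matrix.trace, Fin.sum_univ_two]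

def symOpSl (p q : Fin 2) : SL2 K :=
  ⟨symOp p q, by
    change Matrix.traceLinearMap (Fin 2) K K _ = 0
    exact symOp_trace p q⟩

/-- The bracket of two odd elements: on pure tensors, the `i`-th component of
`[u₁⊗u₂⊗u₃, w₁⊗w₂⊗w₃]` is
`(ε_i, ε_i) * (∏_{j ≠ i} ω(u_j, w_j)) * (z ↦ ω(w_i, z) u_i + ω(u_i, z) w_i)`. -/
def oddBracket : ((Fin 3 → Fin 2) → K) →ₗ[K] ((Fin 3 → Fin 2) → K) →ₗ[K] (Fin 3 → SL2 K) :=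
  LinearMap.mk₂ K
    (fun v w i => ∑ s : Fin 3 → Fin 2, ∑ t : Fin 3 → Fin 2,
      (v s * w t * epsNorm a i * ∏ j ∈ Finset.univ.erase i, omega (s j) (t j)) •
        symOpSl (s i) (t i))
    (fun v v' w => by
      funext i; simp only [Pi.add_apply, add_mul, add_smul, Finset.sum_add_distrib])
    (fun c v w => by
      funext i; simp only [Pi.smul_apply, smul_eq_mul, Finset.smul_sum, smul_smul, mul_assoc])
    (fun v w w' => by
      funext i
      simp only [Pi.add_apply, mul_add, add_mul, add_smul, Finset.sum_add_distrib])
    (fun c v w => by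
      funext i
      simp only [Pi.smul_apply, smul_eq_mul, Finset.smul_sum, smul_smul]
      refine Finset.sum_congr rfl fun s _ => Finset.sum_congr rfl fun t _ => ?_
      congr 1; ring)

/-- The natural action of `𝔰𝔩₂ ⊕ 𝔰𝔩₂ ⊕ 𝔰𝔩₂` on `K² ⊗ K² ⊗ K²`. -/
def tensorAct : (Fin 3 → SL2 K) →ₗ[K] ((Fin 3 → Fin 2) → K) →ₗ[K] ((Fin 3 → Fin 2) → K) :=
  LinearMap.mk₂ K
    (fun x v s => ∑ i : Fin 3, ∑ q : Fin 2, (x i).val (s i) q * v (Function.update s i q))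
    (fun x x' v => by
      funext s
      simp [add_mul, Finset.sum_add_distrib])
    (fun c x v => by
      funext s
      simp [Finset.mul_sum, mul_assoc, mul_add])
    (fun x v v' => by
      funext s
      simp only [Pi.add_apply, mul_add, Finset.sum_add_distrib])
    (fun c x v => by
      funext s
      simp only [Pi.smul_apply, smul_eq_mul, Finset.mul_sum]
      refine Finset.sum_congr rfl fun s _ => Finset.sum_congr rfl fun t _ => ?_
      ring)

/-- The componentwise bracket of `𝔰𝔩₂ ⊕ 𝔰𝔩₂ ⊕ 𝔰𝔩₂`. -/
def lie3 : (Fin 3 → SL2 K) →ₗ[K] (Fin 3 → SL2 K) →ₗ[K] (Fin 3 → SL2 K) :=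
  LinearMap.mk₂ K (fun x y i => ⁅x i, y i⁆)
    (fun x x' y => by funext i; simp) (fun c x y => by funext i; simp)
    (fun x y y' => by funext i; simp) (fun c x y => by funext i; simp)

@[simp] lemma lie3_apply (x y : Fin 3 → SL2 K) (i : Fin 3) : lie3 x y i = ⁅x i, y i⁆ := rfl

/-- The bracket of `D(2,1;a)`. -/
def d21Bracket : D21 K a →ₗ[K] D21 K a →ₗ[K] D21 K a :=
  LinearMap.mk₂ K
    (fun x y => ((lie3 x.1 y.1 + oddBracket a x.2 y.2, tensorAct x.1 y.2 - tensorAct y.1 x.2) :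
      (Fin 3 → SL2 K) × ((Fin 3 → Fin 2) → K)))
    (fun x x' y => by
      refine Prod.ext ?_ ?_
      · change lie3 (x.1 + x'.1) y.1 + oddBracket a (x.2 + x'.2) y.2 =
          lie3 x.1 y.1 + oddBracket a x.2 y.2 + (lie3 x'.1 y.1 + oddBracket a x'.2 y.2)
        rw [map_add, LinearMap.add_apply, map_add, LinearMap.add_apply]; abel
      · change tensorAct (x.1 + x'.1) y.2 - tensorAct y.1 (x.2 + x'.2) =
          tensorAct x.1 y.2 - tensorAct y.1 x.2 + (tensorAct x'.1 y.2 - tensorAct y.1 x'.2)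
        rw [map_add, map_add, LinearMap.add_apply]; abel)
    (fun c x y => by
      refine Prod.ext ?_ ?_
      · change lie3 (c • x.1) y.1 + oddBracket a (c • x.2) y.2 =
          c • (lie3 x.1 y.1 + oddBracket a x.2 y.2)
        rw [map_smul, LinearMap.smul_apply, map_smul, LinearMap.smul_apply, smul_add]
      · change tensorAct (c • x.1) y.2 - tensorAct y.1 (c • x.2) =
          c • (tensorAct x.1 y.2 - tensorAct y.1 x.2)
        rw [map_smul, map_smul, LinearMap.smul_apply, smul_sub])
    (fun x y y' => by
      refine Prod.ext ?_ ?_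
      · change lie3 x.1 (y.1 + y'.1) + oddBracket a x.2 (y.2 + y'.2) =
          lie3 x.1 y.1 + oddBracket a x.2 y.2 + (lie3 x.1 y'.1 + oddBracket a x.2 y'.2)
        rw [map_add, map_add]; abel
      · change tensorAct x.1 (y.2 + y'.2) - tensorAct (y.1 + y'.1) x.2 =
          tensorAct x.1 y.2 - tensorAct y.1 x.2 + (tensorAct x.1 y'.2 - tensorAct y'.1 x.2)
        rw [map_add, map_add, LinearMap.add_apply]; abel)
    (fun c x y => by
      refine Prod.ext ?_ ?_
      · change lie3 x.1 (c • y.1) + oddBracket a x.2 (c • y.2) =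
          c • (lie3 x.1 y.1 + oddBracket a x.2 y.2)
        rw [map_smul, map_smul, smul_add]
      · change tensorAct x.1 (c • y.2) - tensorAct (c • y.1) x.2 =
          c • (tensorAct x.1 y.2 - tensorAct y.1 x.2)
        rw [map_smul, map_smul, LinearMap.smul_apply, smul_sub])

def tripleEquiv : (Fin 3 → Fin 2) ≃ Fin 2 × Fin 2 × Fin 2 where
  toFun s := (s 0, s 1, s 2)
  invFun p := ![p.1, p.2.1, p.2.2]
  left_inv s := by funext i; fin_cases i <;> rfl
  right_inv p := rfl

lemma sum_triple {β : Type*} [AddCommMonoid β] (f : (Fin 3 → Fin 2) → β) :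
    ∑ s, f s = ∑ p, ∑ q, ∑ r, f ![p, q, r] := by
  rw [← Equiv.sum_comp tripleEquiv.symm f, Fintype.sum_prod_type]
  refine Finset.sum_congr rfl fun p _ => ?_
  rw [Fintype.sum_prod_type]; rfl

lemma forall_triple {P : (Fin 3 → Fin 2) → Prop} (h : ∀ p q r, P ![p, q, r]) (s) : P s := by
  have := h (s 0) (s 1) (s 2)
  convert this using 1
  funext i; fin_cases i <;> rfl

lemma upd0 (p q r t : Fin 2) : Function.update ![p, q, r] 0 t = ![t, q, r] := by
  funext i; fin_cases i <;> rfl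
lemma upd1 (p q r t : Fin 2) : Function.update ![p, q, r] 1 t = ![p, t, r] := by
  funext i; fin_cases i <;> rfl
lemma upd2 (p q r t : Fin 2) : Function.update ![p, q, r] 2 t = ![p, q, t] := by
  funext i; fin_cases i <;> rfl
lemma er0 : (Finset.univ.erase 0 : Finset (Fin 3)) = {1, 2} := by decide
lemma er1 : (Finset.univ.erase 1 : Finset (Fin 3)) = {0, 2} := by decide
lemma er2 : (Finset.univ.erase 2 : Finset (Fin 3)) = {0, 1} := by decide

lemma tensorAct_apply (x : Fin 3 → SL2 K) (v : (Fin 3 → Fin 2) → K) (p q r : Fin 2) :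
    tensorAct x v ![p, q, r] =
      ((x 0).val p 0 * v ![0, q, r] + (x 0).val p 1 * v ![1, q, r]) +
      ((x 1).val q 0 * v ![p, 0, r] + (x 1).val q 1 * v ![p, 1, r]) +
      ((x 2).val r 0 * v ![p, q, 0] + (x 2).val r 1 * v ![p, q, 1]) := by
  simp [tensorAct, Fin.sum_univ_three, upd0, upd1, upd2]

lemma tensorAct_lie (x y : Fin 3 → SL2 K) (v : (Fin 3 → Fin 2) → K) :
    tensorAct (lie3 x y) v = tensorAct x (tensorAct y v) - tensorAct y (tensorAct x v) := by
  funext s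
  revert s
  refine forall_triple fun p q r => ?_
  simp only [Pi.sub_apply, tensorAct_apply, lie3_apply, LieAlgebra.SpecialLinear.sl_bracket,
    Matrix.sub_apply, Matrix.mul_apply, Fin.sum_univ_two]
  ring

lemma tr_zero (x : SL2 K) : x.val 1 1 = - x.val 0 0 := by
  have : x.val.trace = 0 := x.2
  rw [Matrix.trace_fin_two] at this
  linear_combination this

lemma oddBracket_apply (v w : (Fin 3 → Fin 2) → K) (i : Fin 3) (m n : Fin 2) :
    (oddBracket a v w i).val m n = ∑ s : Fin 3 → Fin 2, ∑ t : Fin 3 → Fin 2,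
      (v s * w t * epsNorm a i * ∏ j ∈ Finset.univ.erase i, omega (s j) (t j)) *
        symOp (s i) (t i) m n := by
  simp [oddBracket, Matrix.sum_apply, symOpSl]

lemma oddBracket_symm (v w : (Fin 3 → Fin 2) → K) : oddBracket a v w = oddBracket a w v := by
  funext i
  refine Subtype.ext (Matrix.ext fun m n => ?_)
  rw [oddBracket_apply, oddBracket_apply, Finset.sum_comm]
  refine Finset.sum_congr rfl fun s _ => Finset.sum_congr rfl fun t _ => ?_
  have h1 : symOp (K := K) (t i) (s i) m n = symOp (s i) (t i) m n := by
    simp [symOp, add_comm]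
  have h0 : ∀ p q : Fin 2, omega (K := K) p q = - omega q p := by
    intro p q; fin_cases p <;> fin_cases q <;> simp [omega]
  have h2 : ∏ j ∈ Finset.univ.erase i, omega (K := K) (t j) (s j) =
      ∏ j ∈ Finset.univ.erase i, omega (s j) (t j) := by
    rw [Finset.prod_congr rfl fun j _ => h0 (t j) (s j), Finset.prod_neg,
      Finset.card_erase_of_mem (Finset.mem_univ _)]
    simp
  rw [h1, h2]; ring


lemma lie3_jacobi (x y z : Fin 3 → SL2 K) :
    lie3 x (lie3 y z) + lie3 y (lie3 z x) + lie3 z (lie3 x y) = 0 := by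
  funext i
  simp only [Pi.add_apply, lie3_apply, Pi.zero_apply]
  exact lie_jacobi _ _ _

lemma lie3_skew (x y : Fin 3 → SL2 K) : lie3 x y + lie3 y x = 0 := by
  funext i
  simp only [Pi.add_apply, lie3_apply, Pi.zero_apply]
  rw [← lie_skew, neg_add_cancel]

lemma omega_val : omega (K := K) 0 0 = 0 ∧ omega (K := K) 0 1 = 1 ∧ omega (K := K) 1 0 = -1 ∧
    omega (K := K) 1 1 = 0 := by simp [omega]

lemma symOp_val (p q : Fin 2) : symOp (K := K) p q 0 0 = (if p = q then 0 else -1) ∧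
    symOp (K := K) p q 0 1 = (if p = 0 ∧ q = 0 then 2 else 0) ∧
    symOp (K := K) p q 1 0 = (if p = 1 ∧ q = 1 then -2 else 0) := by
  fin_cases p <;> fin_cases q <;> refine ⟨?_, ?_, ?_⟩ <;> norm_num [symOp, omega]

lemma oddBracket_sum0 (v w : (Fin 3 → Fin 2) → K) (m n : Fin 2) :
    (oddBracket a v w 0).val m n = ∑ p, ∑ q, ∑ r, ∑ p', ∑ q', ∑ r',
      (v ![p, q, r] * w ![p', q', r'] * epsNorm a 0 * (omega q q' * omega r r')) *
        symOp p p' m n := by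
  simp only [oddBracket_apply, sum_triple, er0]
  refine Finset.sum_congr rfl fun p _ => Finset.sum_congr rfl fun q _ =>
    Finset.sum_congr rfl fun r _ => Finset.sum_congr rfl fun p' _ =>
    Finset.sum_congr rfl fun q' _ => Finset.sum_congr rfl fun r' _ => ?_
  rw [Finset.prod_pair (by decide)]; rfl

lemma oddBracket_sum1 (v w : (Fin 3 → Fin 2) → K) (m n : Fin 2) :
    (oddBracket a v w 1).val m n = ∑ p, ∑ q, ∑ r, ∑ p', ∑ q', ∑ r',
      (v ![p, q, r] * w ![p', q', r'] * epsNorm a 1 * (omega p p' * omega r r')) *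
        symOp q q' m n := by
  simp only [oddBracket_apply, sum_triple, er1]
  refine Finset.sum_congr rfl fun p _ => Finset.sum_congr rfl fun q _ =>
    Finset.sum_congr rfl fun r _ => Finset.sum_congr rfl fun p' _ =>
    Finset.sum_congr rfl fun q' _ => Finset.sum_congr rfl fun r' _ => ?_
  rw [Finset.prod_pair (by decide)]; rfl

lemma oddBracket_sum2 (v w : (Fin 3 → Fin 2) → K) (m n : Fin 2) :
    (oddBracket a v w 2).val m n = ∑ p, ∑ q, ∑ r, ∑ p', ∑ q', ∑ r',
      (v ![p, q, r] * w ![p', q', r'] * epsNorm a 2 * (omega p p' * omega q q')) *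
        symOp r r' m n := by
  simp only [oddBracket_apply, sum_triple, er2]
  refine Finset.sum_congr rfl fun p _ => Finset.sum_congr rfl fun q _ =>
    Finset.sum_congr rfl fun r _ => Finset.sum_congr rfl fun p' _ =>
    Finset.sum_congr rfl fun q' _ => Finset.sum_congr rfl fun r' _ => ?_
  rw [Finset.prod_pair (by decide)]; rfl

lemma oddBracket_entry0 (v w : (Fin 3 → Fin 2) → K) :
    (oddBracket a v w 0).val 0 0 = -epsNorm a 0 *
      ((v ![0, 0, 0] * w ![1, 1, 1] - v ![0, 0, 1] * w ![1, 1, 0] - v ![0, 1, 0] * w ![1, 0, 1] + v ![0, 1, 1] * w ![1, 0, 0]) +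
        (v ![1, 0, 0] * w ![0, 1, 1] - v ![1, 0, 1] * w ![0, 1, 0] - v ![1, 1, 0] * w ![0, 0, 1] + v ![1, 1, 1] * w ![0, 0, 0])) ∧
    (oddBracket a v w 0).val 0 1 = 2 * epsNorm a 0 *
      (v ![0, 0, 0] * w ![0, 1, 1] - v ![0, 0, 1] * w ![0, 1, 0] - v ![0, 1, 0] * w ![0, 0, 1] + v ![0, 1, 1] * w ![0, 0, 0]) ∧
    (oddBracket a v w 0).val 1 0 = -2 * epsNorm a 0 *
      (v ![1, 0, 0] * w ![1, 1, 1] - v ![1, 0, 1] * w ![1, 1, 0] - v ![1, 1, 0] * w ![1, 0, 1] + v ![1, 1, 1] * w ![1, 0, 0]) := by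
  refine ⟨?_, ?_, ?_⟩ <;>
  · rw [oddBracket_sum0]
    simp only [Fin.sum_univ_two, symOp_val, omega_val, mul_zero, zero_mul, add_zero, zero_add,
      if_true, if_false, zero_ne_one, one_ne_zero, and_true, and_false, mul_one]
    ring

lemma oddBracket_entry1 (v w : (Fin 3 → Fin 2) → K) :
    (oddBracket a v w 1).val 0 0 = -epsNorm a 1 *
      ((v ![0, 0, 0] * w ![1, 1, 1] - v ![0, 0, 1] * w ![1, 1, 0] - v ![1, 0, 0] * w ![0, 1, 1] + v ![1, 0, 1] * w ![0, 1, 0]) +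
        (v ![0, 1, 0] * w ![1, 0, 1] - v ![0, 1, 1] * w ![1, 0, 0] - v ![1, 1, 0] * w ![0, 0, 1] + v ![1, 1, 1] * w ![0, 0, 0])) ∧
    (oddBracket a v w 1).val 0 1 = 2 * epsNorm a 1 *
      (v ![0, 0, 0] * w ![1, 0, 1] - v ![0, 0, 1] * w ![1, 0, 0] - v ![1, 0, 0] * w ![0, 0, 1] + v ![1, 0, 1] * w ![0, 0, 0]) ∧
    (oddBracket a v w 1).val 1 0 = -2 * epsNorm a 1 *
      (v ![0, 1, 0] * w ![1, 1, 1] - v ![0, 1, 1] * w ![1, 1, 0] - v ![1, 1, 0] * w ![0, 1, 1] + v ![1, 1, 1] * w ![0, 1, 0]) := by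
  refine ⟨?_, ?_, ?_⟩ <;>
  · rw [oddBracket_sum1]
    simp only [Fin.sum_univ_two, symOp_val, omega_val, mul_zero, zero_mul, add_zero, zero_add,
      if_true, if_false, zero_ne_one, one_ne_zero, and_true, and_false, mul_one]
    ring

lemma oddBracket_entry2 (v w : (Fin 3 → Fin 2) → K) :
    (oddBracket a v w 2).val 0 0 = -epsNorm a 2 *
      ((v ![0, 0, 0] * w ![1, 1, 1] - v ![0, 1, 0] * w ![1, 0, 1] - v ![1, 0, 0] * w ![0, 1, 1] + v ![1, 1, 0] * w ![0, 0, 1]) +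
        (v ![0, 0, 1] * w ![1, 1, 0] - v ![0, 1, 1] * w ![1, 0, 0] - v ![1, 0, 1] * w ![0, 1, 0] + v ![1, 1, 1] * w ![0, 0, 0])) ∧
    (oddBracket a v w 2).val 0 1 = 2 * epsNorm a 2 *
      (v ![0, 0, 0] * w ![1, 1, 0] - v ![0, 1, 0] * w ![1, 0, 0] - v ![1, 0, 0] * w ![0, 1, 0] + v ![1, 1, 0] * w ![0, 0, 0]) ∧
    (oddBracket a v w 2).val 1 0 = -2 * epsNorm a 2 *
      (v ![0, 0, 1] * w ![1, 1, 1] - v ![0, 1, 1] * w ![1, 0, 1] - v ![1, 0, 1] * w ![0, 1, 1] + v ![1, 1, 1] * w ![0, 0, 1]) := by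
  refine ⟨?_, ?_, ?_⟩ <;>
  · rw [oddBracket_sum2]
    simp only [Fin.sum_univ_two, symOp_val, omega_val, mul_zero, zero_mul, add_zero, zero_add,
      if_true, if_false, zero_ne_one, one_ne_zero, and_true, and_false, mul_one]
    ring

lemma oddBracket_tensorAct (x : Fin 3 → SL2 K) (v w : (Fin 3 → Fin 2) → K) :
    lie3 x (oddBracket a v w) =
      oddBracket a (tensorAct x v) w + oddBracket a v (tensorAct x w) := by
  have key (y z : SL2 K) (h1 : y.val 0 0 = z.val 0 0) (h2 : y.val 0 1 = z.val 0 1)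
      (h3 : y.val 1 0 = z.val 1 0) : y = z := by
    refine Subtype.ext (Matrix.ext fun m n => ?_)
    have h4 : y.val 1 1 = z.val 1 1 := by rw [tr_zero, tr_zero, h1]
    fin_cases m <;> fin_cases n <;> assumption
  funext i
  have h0 := tr_zero (x i)
  have hh := tr_zero (oddBracket a v w i)
  have e (m n : Fin 2) : (lie3 x (oddBracket a v w) i).val m n =
      ((x i).val m 0 * (oddBracket a v w i).val 0 n + (x i).val m 1 * (oddBracket a v w i).val 1 n) -
      ((oddBracket a v w i).val m 0 * (x i).val 0 n +
        (oddBracket a v w i).val m 1 * (x i).val 1 n) := by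
    rw [lie3_apply, LieAlgebra.SpecialLinear.sl_bracket, Matrix.sub_apply, Matrix.mul_apply,
      Matrix.mul_apply, Fin.sum_univ_two, Fin.sum_univ_two]
  have f (m n : Fin 2) :
      ((oddBracket a (tensorAct x v) w + oddBracket a v (tensorAct x w)) i).val m n =
      (oddBracket a (tensorAct x v) w i).val m n + (oddBracket a v (tensorAct x w) i).val m n :=
    rfl
  have t0 := tr_zero (x 0)
  have t1 := tr_zero (x 1)
  have t2 := tr_zero (x 2)
  refine key _ _ ?_ ?_ ?_ <;> rw [e, f] <;> (try simp only [h0, hh]) <;> fin_cases i <;>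
  · simp only [Fin.zero_eta, Fin.mk_one, Fin.reduceFinMk, (oddBracket_entry0 a _ _).1,
      (oddBracket_entry0 a _ _).2.1, (oddBracket_entry0 a _ _).2.2, (oddBracket_entry1 a _ _).1,
      (oddBracket_entry1 a _ _).2.1, (oddBracket_entry1 a _ _).2.2, (oddBracket_entry2 a _ _).1,
      (oddBracket_entry2 a _ _).2.1, (oddBracket_entry2 a _ _).2.2, tensorAct_apply, t0, t1, t2]
    ring

lemma odd_jacobi (u v w : (Fin 3 → Fin 2) → K) :
    tensorAct (oddBracket a v w) u + tensorAct (oddBracket a w u) v +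
      tensorAct (oddBracket a u v) w = 0 := by
  funext s
  revert s
  refine forall_triple fun p q r => ?_
  have e : epsNorm a 0 = - epsNorm a 1 - epsNorm a 2 := by
    simp [epsNorm]; ring
  simp only [Pi.add_apply, Pi.zero_apply, tensorAct_apply]
  fin_cases p <;> fin_cases q <;> fin_cases r <;>
  · simp only [Fin.zero_eta, Fin.mk_one, tr_zero, (oddBracket_entry0 a _ _).1,
      (oddBracket_entry0 a _ _).2.1, (oddBracket_entry0 a _ _).2.2, (oddBracket_entry1 a _ _).1,
      (oddBracket_entry1 a _ _).2.1, (oddBracket_entry1 a _ _).2.2, (oddBracket_entry2 a _ _).1,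
      (oddBracket_entry2 a _ _).2.1, (oddBracket_entry2 a _ _).2.2, e]
    ring


/-- Even elements have zero odd component, odd elements have zero even component. -/
def d21Grading (i : ZMod 2) : Submodule K (D21 K a) where
  carrier := {x | if i = 0 then x.2 = 0 else x.1 = 0}
  add_mem' := by
    intro x y hx hy
    change if i = 0 then x.2 + y.2 = 0 else x.1 + y.1 = 0
    split_ifs with h <;> simp_all
  zero_mem' := by
    change if i = 0 then (0 : (Fin 3 → Fin 2) → K) = 0 else (0 : Fin 3 → SL2 K) = 0
    split_ifs <;> rfl
  smul_mem' := by
    intro c x hx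
    change if i = 0 then c • x.2 = 0 else c • x.1 = 0
    split_ifs with h <;> simp_all

lemma mem_d21Grading_zero {x : D21 K a} : x ∈ d21Grading a 0 ↔ x.2 = 0 := by
  change (if (0 : ZMod 2) = 0 then x.2 = 0 else x.1 = 0) ↔ _
  simp

lemma mem_d21Grading_one {x : D21 K a} : x ∈ d21Grading a 1 ↔ x.1 = 0 := by
  change (if (1 : ZMod 2) = 0 then x.2 = 0 else x.1 = 0) ↔ _
  simp

lemma d21Bracket_fst (x y : D21 K a) :
    (d21Bracket a x y).1 = lie3 x.1 y.1 + oddBracket a x.2 y.2 := rfl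

lemma d21Bracket_snd (x y : D21 K a) :
    (d21Bracket a x y).2 = tensorAct x.1 y.2 - tensorAct y.1 x.2 := rfl

lemma d21Grading_isInternal : DirectSum.IsInternal (d21Grading a) := by
  rw [DirectSum.isInternal_submodule_iff_isCompl (d21Grading a) (i := 0) (j := 1) (by decide)
    (by ext i; revert i; simp only [Set.mem_univ, Set.mem_insert_iff, Set.mem_singleton_iff]; decide)]
  constructor
  · rw [Submodule.disjoint_def]
    intro x h0 h1
    exact Prod.ext ((mem_d21Grading_one a).1 h1) ((mem_d21Grading_zero a).1 h0)
  · rw [codisjoint_iff, eq_top_iff]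
    intro x _
    refine Submodule.mem_sup.2 ⟨((x.1, 0) : (Fin 3 → SL2 K) × ((Fin 3 → Fin 2) → K)),
      (mem_d21Grading_zero a).2 rfl, ((0, x.2) : (Fin 3 → SL2 K) × ((Fin 3 → Fin 2) → K)),
      (mem_d21Grading_one a).2 rfl, Prod.ext ?_ ?_⟩
    · exact add_zero _
    · exact zero_add _

lemma d21_ext {x y : D21 K a} (h1 : x.1 = y.1) (h2 : x.2 = y.2) : x = y := Prod.ext h1 h2

lemma zmod2_cases (i : ZMod 2) : i = 0 ∨ i = 1 := by revert i; decide

lemma d21_add_fst (x y : D21 K a) : (x + y).1 = x.1 + y.1 := rfl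
lemma d21_add_snd (x y : D21 K a) : (x + y).2 = x.2 + y.2 := rfl
lemma d21_zsmul_fst (n : ℤ) (x : D21 K a) : (n • x).1 = n • x.1 := rfl
lemma d21_zsmul_snd (n : ℤ) (x : D21 K a) : (n • x).2 = n • x.2 := rfl
lemma d21_zero_fst : (0 : D21 K a).1 = 0 := rfl
lemma d21_zero_snd : (0 : D21 K a).2 = 0 := rfl

/-- `D(2,1;a)` is a Lie superalgebra. -/
instance : LieSuperalgebra K (D21 K a) where
  grading := d21Grading a
  isInternal := d21Grading_isInternal a
  bracket := d21Bracket a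
  bracket_mem := by
    intro i j x y hx hy
    rcases zmod2_cases i with rfl | rfl <;> rcases zmod2_cases j with rfl | rfl <;>
      simp only [mem_d21Grading_zero, mem_d21Grading_one] at hx hy
    · rw [add_zero, mem_d21Grading_zero, d21Bracket_snd, hx, hy]; simp
    · rw [zero_add, mem_d21Grading_one, d21Bracket_fst, hx, hy]; simp
    · rw [add_zero, mem_d21Grading_one, d21Bracket_fst, hx, hy]; simp
    · rw [show (1 + 1 : ZMod 2) = 0 from rfl, mem_d21Grading_zero, d21Bracket_snd, hx, hy]; simp
  bracket_skew := by
    intro i j x y hx hy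
    have k0 : koszul 0 0 = 1 := by decide
    have k1 : koszul 0 1 = 1 := by decide
    have k2 : koszul 1 0 = 1 := by decide
    have k3 : koszul 1 1 = -1 := by decide
    refine d21_ext a ?_ ?_ <;>
      simp only [d21_add_fst, d21_add_snd, d21_zsmul_fst, d21_zsmul_snd, d21Bracket_fst,
        d21Bracket_snd, d21_zero_fst, d21_zero_snd] <;>
      rcases zmod2_cases i with rfl | rfl <;> rcases zmod2_cases j with rfl | rfl <;>
      simp only [mem_d21Grading_zero, mem_d21Grading_one] at hx hy <;>
      simp [hx, hy, k0, k1, k2, k3, lie3_skew, oddBracket_symm a x.2 y.2]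
  jacobi := by
    intro i j l x y z hx hy hz
    have k0 : koszul 0 0 = 1 := by decide
    have k1 : koszul 0 1 = 1 := by decide
    have k2 : koszul 1 0 = 1 := by decide
    have k3 : koszul 1 1 = -1 := by decide
    refine d21_ext a ?_ ?_ <;>
      simp only [d21_add_fst, d21_add_snd, d21_zsmul_fst, d21_zsmul_snd, d21Bracket_fst,
        d21Bracket_snd, d21_zero_fst, d21_zero_snd] <;>
      rcases zmod2_cases i with rfl | rfl <;> rcases zmod2_cases j with rfl | rfl <;>
      rcases zmod2_cases l with rfl | rfl <;>
      simp only [mem_d21Grading_zero, mem_d21Grading_one] at hx hy hz <;>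
      simp only [hx, hy, hz, k0, k1, k2, k3, map_zero, LinearMap.zero_apply, add_zero, zero_add,
        sub_zero, zero_sub, smul_zero, map_neg, one_smul, neg_smul, neg_zero,
        neg_neg, tensorAct_lie, lie3_jacobi, oddBracket_tensorAct]
    · rw [oddBracket_symm a z.2 (tensorAct x.1 y.2)]; abel
    · rw [oddBracket_symm a x.2 (tensorAct y.1 z.2)]; abel
    · rw [oddBracket_symm a y.2 (tensorAct z.1 x.2)]; abel
    · abel
    · abel
    · abel
    · exact odd_jacobi a x.2 y.2 z.2

end Construction

section Roots
variable {K : Type*} [Field K]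

/-- Roots are given by their integer coordinates in the basis `ε₁, ε₂, ε₃`. The even positive
(`s = 1`) or negative (`s = -1`) roots `2sε₁, 2sε₂, 2sε₃`. -/
def evenRoots (s : ℤˣ) : Set (Fin 3 → ℤ) := {α | ∃ i, α = Pi.single i (2 * (s : ℤ))}

/-- The odd positive (`s = 1`) or negative (`s = -1`) roots `sε₁ ± ε₂ ± ε₃`. -/
def oddRoots (s : ℤˣ) : Set (Fin 3 → ℤ) := {γ | γ 0 = s ∧ ∀ i, γ i = 1 ∨ γ i = -1}

/-- The even roots. -/
def roots₀ : Set (Fin 3 → ℤ) := evenRoots 1 ∪ evenRoots (-1)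

/-- The odd roots. -/
def roots₁ : Set (Fin 3 → ℤ) := oddRoots 1 ∪ oddRoots (-1)

/-- All roots. -/
def roots : Set (Fin 3 → ℤ) := roots₀ ∪ roots₁

/-- The inner product for which `ε₁, ε₂, ε₃` are orthogonal of squares `epsNorm a`. -/
def rootForm (a : K) (α β : Fin 3 → ℤ) : K := ∑ i, epsNorm a i * (α i : K) * (β i : K)

/-- The matrix `diag(1, -1)`. -/
def diagSl : SL2 K :=
  ⟨!![1, 0; 0, -1], by
    change Matrix.traceLinearMap (Fin 2) K K _ = 0
    simp [Matrix.trace_fin_two]⟩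

/-- The Cartan subalgebra, in the coordinates given by the basis of the three even coroots
`H_{2ε₁}, H_{2ε₂}, H_{2ε₃}`; it is embedded in `D(2,1;a)` by `cartanIncl`. -/
abbrev Cartan (K : Type*) : Type _ := Fin 3 → K

/-- The embedding of the Cartan subalgebra, as the triples of diagonal matrices. -/
def cartanIncl (a : K) : Cartan K →ₗ[K] D21 K a where
  toFun c := ((fun i => c i • diagSl, 0) : (Fin 3 → SL2 K) × ((Fin 3 → Fin 2) → K))
  map_add' c d := Prod.ext (funext fun i => add_smul (c i) (d i) diagSl) (add_zero _).symm
  map_smul' r c := Prod.ext (funext fun i => mul_smul r (c i) diagSl) (smul_zero _).symm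

/-- A root as a linear functional on the Cartan subalgebra; `2ε_i` takes the value `2` on
`H_{2ε_i}` and `ε_j` vanishes on it for `j ≠ i`. -/
def rootEval (α : Fin 3 → ℤ) : Cartan K →ₗ[K] K :=
  ∑ i, (α i : K) • LinearMap.proj i

open Classical in
/-- The coroot `H_α`: `H_{±2ε_i} = ±H_{2ε_i}`, and for an odd root `γ`
`H_γ = -∑_i (ε_i, ε_i) γ_i H_{2ε_i}`, so that `H_{-α} = -H_α` for every root. For the simple odd root
`α₁ = ε₁ - ε₂ - ε₃` this is `h₁`, and for `ε₁ + ε₂ - ε₃`, `ε₁ - ε₂ + ε₃`, `ε₁ + ε₂ + ε₃` it is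
`h₁ - h₂`, `h₁ - a h₃`, `h₁ - h₂ - a h₃`, where `h₂ = H_{2ε₂}`, `h₃ = H_{2ε₃}` and
`2 h₁ - h₂ - a h₃ = (1 + a) H_{2ε₁}`. -/
def coroot (a : K) (α : Fin 3 → ℤ) : Cartan K :=
  if α ∈ roots₁ then fun i => -(epsNorm a i * (α i : K)) else fun i => (α i : K) / 2

/-- The subring `ℤ[a]` of `K`. -/
def adjoinZ (a : K) : Subring K := Subring.closure {a}

open LieSuperalgebra in
/-- A Chevalley basis of `D(2,1;a)`. The family `X` is extended by `0` outside the roots; `r` in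
`bracket_X_X` is the length of the descending part of the `α`-string through `β`. -/
structure ChevalleyBasis (a : K) where
  H : Module.Basis (Fin 3) K (Cartan K)
  X : (Fin 3 → ℤ) → D21 K a
  X_eq_zero : ∀ α, α ∉ roots → X α = 0
  X_even : ∀ α ∈ roots₀, X α ∈ grading (K := K) (L := D21 K a) 0
  X_odd : ∀ γ ∈ roots₁, X γ ∈ grading (K := K) (L := D21 K a) 1
  linearIndependent : LinearIndependent K
    (Sum.elim (fun i => cartanIncl a (H i)) (fun α : roots => X α))
  span_eq_top : Submodule.span K
    (Set.range (Sum.elim (fun i => cartanIncl a (H i)) (fun α : roots => X α))) = ⊤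
  span_coroots : Submodule.span (adjoinZ a) (Set.range H) =
    Submodule.span (adjoinZ a) (coroot a '' roots)
  bracket_H_H : ∀ i j, bracket (K := K) (cartanIncl a (H i)) (cartanIncl a (H j)) = 0
  bracket_H_X : ∀ i, ∀ α ∈ roots,
    bracket (K := K) (cartanIncl a (H i)) (X α) = rootEval α (H i) • X α
  bracket_X_neg : ∀ α ∈ roots, α ∉ oddRoots (-1) →
    bracket (K := K) (X α) (X (-α)) = cartanIncl a (coroot a α)
  bracket_X_neg_odd : ∀ α ∈ oddRoots (-1),
    bracket (K := K) (X α) (X (-α)) = -cartanIncl a (coroot a α)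
  bracket_X_X : ∀ α ∈ roots, ∀ β ∈ roots, α + β ≠ 0 → ∃ c : K,
    bracket (K := K) (X α) (X β) = c • X (α + β) ∧
    (α + β ∉ roots → c = 0) ∧
    (α + β ∈ roots → (rootForm a α α ≠ 0 ∨ rootForm a β β ≠ 0) → ∀ r : ℕ,
      IsGreatest {r : ℕ | β - (r : ℤ) • α ∈ roots ∪ {0}} r → c = r + 1 ∨ c = -(r + 1)) ∧
    (α + β ∈ roots → rootForm a α α = 0 → rootForm a β β = 0 →
      c = rootEval β (coroot a α) ∨ c = -rootEval β (coroot a α))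

end Roots

section Enveloping
variable (K : Type*) [CommRing K] (L : Type*) [AddCommGroup L] [Module K L] [LieSuperalgebra K L]

open LieSuperalgebra in
/-- The relations `x y - (-1)^(|x||y|) y x = [x, y]`, for homogeneous `x`, `y`. -/
inductive EnvRel : TensorAlgebra K L → TensorAlgebra K L → Prop
  | of_homogeneous {i j : ZMod 2} {x y : L} (hx : x ∈ grading (K := K) i)
      (hy : y ∈ grading (K := K) j) :
      EnvRel (TensorAlgebra.ι K x * TensorAlgebra.ι K y)
        (koszul i j • (TensorAlgebra.ι K y * TensorAlgebra.ι K x) +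
          TensorAlgebra.ι K (bracket (K := K) x y))

/-- The universal enveloping superalgebra. -/
def Enveloping : Type _ := RingQuot (EnvRel K L)

instance : Ring (Enveloping K L) := inferInstanceAs (Ring (RingQuot (EnvRel K L)))
instance : Algebra K (Enveloping K L) := inferInstanceAs (Algebra K (RingQuot (EnvRel K L)))

/-- The canonical map from the Lie superalgebra to its enveloping algebra. -/
def Enveloping.ι : L →ₗ[K] Enveloping K L :=
  (RingQuot.mkAlgHom K (EnvRel K L)).toLinearMap ∘ₗ TensorAlgebra.ι K

open LieSuperalgebra in
/-- A `ℤ/2`-graded module over a Lie superalgebra, with underlying space `V`. -/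
structure SuperRep (V : Type*) [AddCommGroup V] [Module K V] where
  gradingV : ZMod 2 → Submodule K V
  isInternal : DirectSum.IsInternal gradingV
  act : L →ₗ[K] Module.End K V
  act_mem : ∀ {i j : ZMod 2} {x : L} {v : V}, x ∈ grading (K := K) i → v ∈ gradingV j →
    act x v ∈ gradingV (i + j)
  act_bracket : ∀ {i j : ZMod 2} {x y : L}, x ∈ grading (K := K) i → y ∈ grading (K := K) j →
    act (bracket (K := K) x y) = act x * act y - koszul i j • (act y * act x)

variable {K L} {V : Type*} [AddCommGroup V] [Module K V]

/-- The action of the enveloping superalgebra. -/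
def SuperRep.lift (ρ : SuperRep K L V) : Enveloping K L →ₐ[K] Module.End K V :=
  RingQuot.liftAlgHom K ⟨TensorAlgebra.lift K ρ.act, by
    rintro _ _ ⟨hx, hy⟩
    simp [ρ.act_bracket hx hy]⟩

end Enveloping

section Kostant
variable {K : Type*} [Field K]

/-- The binomial coefficient `y (y - 1) ⋯ (y - n + 1) / n!`. -/
def binom (K : Type*) [Field K] {R : Type*} [Ring R] [Algebra K R] (y : R) (n : ℕ) : R :=
  ((n.factorial : K)⁻¹) • Polynomial.aeval y (descPochhammer K n)

/-- The divided power `y ^ n / n!`. -/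
def divPow (K : Type*) [Field K] {R : Type*} [Ring R] [Algebra K R] (y : R) (n : ℕ) : R :=
  ((n.factorial : K)⁻¹) • y ^ n

/-- The subring `ℤ_a` of `K` generated by the binomial coefficients of the elements of `ℤ[a]`. -/
def Za (a : K) : Subring K :=
  Subring.closure {y | ∃ z ∈ adjoinZ a, ∃ n : ℕ, y = binom K z n}

variable {a : K} (B : ChevalleyBasis a)

/-- `𝔥_{ℤ[a]}`, the `ℤ[a]`-span of `H₁, H₂, H₃`. -/
def ChevalleyBasis.cartanLattice : Submodule (adjoinZ a) (Cartan K) :=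
  Submodule.span (adjoinZ a) (Set.range B.H)

/-- The Kostant superalgebra, generated over `ℤ_a` by the divided powers of the even root vectors,
the odd root vectors, and the binomial coefficients of the elements of `𝔥_{ℤ[a]}`. -/
def ChevalleyBasis.kostant : Subalgebra (Za a) (Enveloping K (D21 K a)) :=
  Algebra.adjoin (Za a)
    ({u | ∃ α ∈ roots₀, ∃ n : ℕ, u = divPow K (Enveloping.ι K _ (B.X α)) n} ∪
     {u | ∃ γ ∈ roots₁, u = Enveloping.ι K _ (B.X γ)} ∪
     {u | ∃ c ∈ B.cartanLattice, ∃ n : ℕ, u = binom K (Enveloping.ι K _ (cartanIncl a c)) n})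

variable {V : Type*} [AddCommGroup V] [Module K V]

/-- The weight space `V_μ`. -/
def weightSpace (ρ : SuperRep K (D21 K a) V) (μ : Cartan K →ₗ[K] K) : Submodule K V where
  carrier := {v | ∀ c : Cartan K, ρ.act (cartanIncl a c) v = μ c • v}
  add_mem' := fun hv hw c => by rw [map_add, hv c, hw c, smul_add]
  zero_mem' := fun c => by rw [map_zero, smul_zero]
  smul_mem' := fun r v hv c => by rw [map_smul, hv c, smul_comm]

/-- Rational modules. -/
structure IsRational (ρ : SuperRep K (D21 K a) V) : Prop where
  iSup_weightSpace : ⨆ μ, weightSpace ρ μ = ⊤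
  weight_H : ∀ μ, weightSpace ρ μ ≠ ⊥ → ∀ i, μ (B.H i) ∈ adjoinZ a
  weight_coroot : ∀ μ, weightSpace ρ μ ≠ ⊥ → ∀ α ∈ roots₀, ∃ n : ℤ, μ (coroot a α) = n

/-- Admissible lattices: `ℤ_a`-spans of a `K`-basis that are stable under the Kostant
superalgebra. -/
structure IsAdmissible (ρ : SuperRep K (D21 K a) V) (M : Submodule (Za a) V) : Prop where
  isLattice : ∃ b : Module.Basis (Fin (Module.finrank K V)) K V,
    M = Submodule.span (Za a) (Set.range b)
  stable : ∀ u ∈ B.kostant, ∀ m ∈ M, ρ.lift u m ∈ M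

variable {B} {ρ : SuperRep K (D21 K a) V} {M : Submodule (Za a) V}

/-- The action of an element of the Kostant superalgebra on an admissible lattice. -/
def IsAdmissible.act (hM : IsAdmissible B ρ M) (u : B.kostant) : Module.End (Za a) M :=
  ((ρ.lift u).restrictScalars (Za a)).restrict fun m hm => hM.stable u u.2 m hm

lemma divPow_mem_kostant (α : roots₀) (n : ℕ) :
    divPow K (Enveloping.ι K _ (B.X α)) n ∈ B.kostant :=
  Algebra.subset_adjoin (Or.inl (Or.inl ⟨α, α.2, n, rfl⟩))

lemma odd_mem_kostant (γ : roots₁) : Enveloping.ι K _ (B.X γ) ∈ B.kostant :=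
  Algebra.subset_adjoin (Or.inl (Or.inr ⟨γ, γ.2, rfl⟩))

end Kostant

section Powers
variable {K : Type*} [Field K] (a : K)

/-- The power series `ℓ^z = ∑_n binom(z, n) (ℓ - 1)^n` over `ℤ_a`, in the variable `ℓ - 1`. -/
def ellPow (z : adjoinZ a) : PowerSeries (Za a) :=
  PowerSeries.mk fun n => ⟨binom K (z : K) n, Subring.subset_closure ⟨z, z.2, n, rfl⟩⟩

/-- `a` as an element of `ℤ[a]`. -/
def adjoinZ.gen : adjoinZ a := ⟨a, Subring.subset_closure rfl⟩

/-- The `ℤ_a`-subalgebra generated by the power series `ℓ^{±a^n}`, `n ≥ 0`. -/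
def ellAlgebra : Subalgebra (Za a) (PowerSeries (Za a)) :=
  Algebra.adjoin (Za a)
    {f | ∃ n : ℕ, f = ellPow a (adjoinZ.gen a ^ n) ∨ f = ellPow a (-(adjoinZ.gen a ^ n))}

variable {a}

lemma binom_eq_choose [CharZero K] (z : K) (n : ℕ) : binom K z n = Ring.choose z n := by
  rw [Ring.choose_eq_smul, binom, ← descPochhammer_map (algebraMap ℤ K),
    Polynomial.aeval_map_algebraMap,    Polynomial.aeval_eq_smeval]

lemma ellPow_add [CharZero K] (z w : adjoinZ a) : ellPow a (z + w) = ellPow a z * ellPow a w := by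
  apply PowerSeries.map_injective (Za a).subtype Subtype.val_injective
  have h (z : adjoinZ a) : PowerSeries.map (Za a).subtype (ellPow a z) =
      PowerSeries.binomialSeries K (z : K) := by
    ext n
    simp [ellPow, binom_eq_choose]
  rw [map_mul, h, h, h, ← PowerSeries.binomialSeries_add]; rfl

lemma ellPow_zero [CharZero K] : ellPow a 0 = 1 := by
  apply PowerSeries.map_injective (Za a).subtype Subtype.val_injective
  have h : PowerSeries.map (Za a).subtype (ellPow a 0) = PowerSeries.binomialSeries K (0 : K) := by
    ext n
    rw [PowerSeries.coeff_map, PowerSeries.binomialSeries_coeff, ← binom_eq_choose]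
    simp [ellPow]
  rw [h, PowerSeries.binomialSeries_zero, map_one]

lemma ellPow_mem [CharZero K] (z : adjoinZ a) : ellPow a z ∈ ellAlgebra a := by
  have hmul (w : adjoinZ a) (hw : ellPow a w ∈ ellAlgebra a) (n : ℕ) :
      ellPow a (n • w) ∈ ellAlgebra a := by
    induction n with
    | zero => rw [zero_smul, ellPow_zero]; exact one_mem _
    | succ n ih => rw [succ_nsmul, ellPow_add]; exact mul_mem ih hw
  have hpoly (p : Polynomial ℤ) : ellPow a (p.aeval (adjoinZ.gen a)) ∈ ellAlgebra a := by
    induction p using Polynomial.induction_on' with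
    | add p q h1 h2 => rw [map_add, ellPow_add]; exact mul_mem h1 h2
    | monomial n c =>
      have e : (Polynomial.monomial n c).aeval (adjoinZ.gen a) = c • adjoinZ.gen a ^ n := by
        rw [Polynomial.aeval_monomial]; simp
      rw [e]
      obtain ⟨m, rfl | rfl⟩ := c.eq_nat_or_neg
      · rw [natCast_zsmul]
        exact hmul _ (Algebra.subset_adjoin ⟨n, Or.inl rfl⟩) m
      · rw [neg_smul, natCast_zsmul, ← smul_neg]
        exact hmul _ (Algebra.subset_adjoin ⟨n, Or.inr rfl⟩) m
  obtain ⟨p, hp⟩ : ∃ p : Polynomial ℤ, p.aeval (adjoinZ.gen a) = z := by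
    obtain ⟨z, hz⟩ := z
    induction hz using Subring.closure_induction with
    | mem x hx => exact ⟨Polynomial.X, by rw [Polynomial.aeval_X]; exact Subtype.ext hx.symm⟩
    | zero => exact ⟨0, map_zero _⟩
    | one => exact ⟨1, map_one _⟩
    | add x y hx hy h1 h2 =>
      obtain ⟨p, hp⟩ := h1; obtain ⟨q, hq⟩ := h2
      exact ⟨p + q, by rw [map_add, hp, hq]; rfl⟩
    | neg x hx h1 => obtain ⟨p, hp⟩ := h1; exact ⟨-p, by rw [map_neg, hp]; rfl⟩
    | mul x y hx hy h1 h2 =>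
      obtain ⟨p, hp⟩ := h1; obtain ⟨q, hq⟩ := h2
      exact ⟨p * q, by rw [map_mul, hp, hq]; rfl⟩
  exact hp ▸ hpoly p

end Powers

section Supergroup
open TensorProduct

/-- `x y = (-1)^(|x||y|) y x` for homogeneous `x`, `y`. -/
def IsSupercommutative {k A : Type*} [CommRing k] [Ring A] [Algebra k A]
    (𝒜 : ZMod 2 → Submodule k A) : Prop :=
  ∀ i j, ∀ x ∈ 𝒜 i, ∀ y ∈ 𝒜 j, x * y = koszul i j • (y * x)

variable {K : Type*} [Field K] {a : K} {B : ChevalleyBasis a}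
  {V : Type*} [AddCommGroup V] [Module K V] {ρ : SuperRep K (D21 K a) V}
  {M : Submodule (Za a) V} (hM : IsAdmissible B ρ M)
  {k : Type*} [CommRing k] [Algebra (Za a) k] {A : Type*} [Ring A] [Algebra k A]
  (𝒜 : ZMod 2 → Submodule k A)

/-- `V_k(A) = A ⊗_k V_k`, where `V_k = k ⊗_{ℤ_a} M`. -/
abbrev IsAdmissible.Points (_hM : IsAdmissible B ρ M) (k : Type*) [CommRing k]
    [Algebra (Za a) k] (A : Type*) [Ring A] [Algebra k A] : Type _ :=
  A ⊗[k] (k ⊗[Za a] M)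

/-- The group of `A`-linear automorphisms of the left `A`-module `V_k(A)`. -/
abbrev IsAdmissible.GL (hM : IsAdmissible B ρ M) (k : Type*) [CommRing k]
    [Algebra (Za a) k] (A : Type*) [Ring A] [Algebra k A] : Type _ :=
  (Module.End A (hM.Points k A))ˣ

/-- The operator `c ⊗ f` on `V_k(A)`, that is, `b ⊗ v ↦ b c ⊗ f v`. When `c` and `f` are homogeneous
of the same parity and `A` is supercommutative, this is `b ⊗ v ↦ (-1)^(|f||b|) c b ⊗ f v`, the usual
action with Koszul sign (`op_koszul` below). -/
def IsAdmissible.op (k : Type*) [CommRing k] [Algebra (Za a) k] {A : Type*} [Ring A] [Algebra k A]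
    (c : A) (f : Module.End (Za a) M) : Module.End A (hM.Points k A) :=
  AlgebraTensorModule.map (LinearMap.toSpanSingleton A A c) (f.baseChange k)

lemma IsAdmissible.op_tmul (c b : A) (f : Module.End (Za a) M) (v : M) :
    hM.op k c f (b ⊗ₜ (1 ⊗ₜ v)) = (b * c) ⊗ₜ (1 ⊗ₜ f v) := by
  simp [IsAdmissible.op]


lemma IsAdmissible.op_koszul (h𝒜 : IsSupercommutative 𝒜) {i j : ZMod 2} {b c : A} (hc : c ∈ 𝒜 i)
    (hb : b ∈ 𝒜 j) (f : Module.End (Za a) M) (v : M) :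
    hM.op k c f (b ⊗ₜ (1 ⊗ₜ v)) = koszul i j • ((c * b) ⊗ₜ (1 ⊗ₜ f v)) := by
  have e : (koszul i j * koszul i j) = 1 := by rw [koszul]; split_ifs <;> rfl
  rw [hM.op_tmul, h𝒜 i j c hc b hb, smul_tmul', smul_smul, e, one_smul]

/-- `x_α(t) = exp(t X_α) = ∑_n t^n X_α^{(n)}` for an even root `α`; only finitely many terms are
nonzero because `X_α` is nilpotent on `V`. -/
def IsAdmissible.xEven (k : Type*) [CommRing k] [Algebra (Za a) k] {A : Type*} [Ring A]
    [Algebra k A] (α : roots₀) (t : A) : Module.End A (hM.Points k A) :=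
  ∑ᶠ n : ℕ, hM.op k (t ^ n) (hM.act ⟨_, divPow_mem_kostant α n⟩)

/-- `x_γ(ϑ) = exp(ϑ X_γ) = 1 + ϑ X_γ` for an odd root `γ`. -/
def IsAdmissible.xOdd (k : Type*) [CommRing k] [Algebra (Za a) k] {A : Type*} [Ring A]
    [Algebra k A] (γ : roots₁) (ϑ : A) : Module.End A (hM.Points k A) :=
  1 + hM.op k ϑ (hM.act ⟨_, odd_mem_kostant γ⟩)

/-- The subgroup `x_α(A)`, `α` an even root. -/
def IsAdmissible.evenOneParam (α : roots₀) : Set (hM.GL k A) :=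
  {g | ∃ t ∈ 𝒜 0, (g : Module.End A (hM.Points k A)) = hM.xEven k α t}

/-- The subgroup `x_γ(A)`, `γ` an odd root. -/
def IsAdmissible.oddOneParam (γ : roots₁) : Set (hM.GL k A) :=
  {g | ∃ ϑ ∈ 𝒜 1, (g : Module.End A (hM.Points k A)) = hM.xOdd k γ ϑ}

/-- The `ℤ`-span of the even coroots. -/
def cartanZ (a : K) : Submodule ℤ (Cartan K) := Submodule.span ℤ (coroot a '' roots₀)

/-- The subgroup `h_H(A)`, `H` in the `ℤ`-span of the even coroots: the operators acting on every
weight space `V_μ` as `t^{μ(H)}`, for a unit `t` of `A₀`. -/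
def IsAdmissible.torusOneParam (c : cartanZ a) : Set (hM.GL k A) :=
  {g | ∃ t : Aˣ, (t : A) ∈ 𝒜 0 ∧ ((t⁻¹ : Aˣ) : A) ∈ 𝒜 0 ∧
    ∀ (μ : Cartan K →ₗ[K] K) (n : ℤ), μ c = n → ∀ m : M, (m : V) ∈ weightSpace ρ μ →
      (g : Module.End A (hM.Points k A)) (1 ⊗ₜ (1 ⊗ₜ m)) = ((t ^ n : Aˣ) : A) ⊗ₜ (1 ⊗ₜ m)}

variable (a) in
/-- The `A`-points of the affine group `P_a`, represented by the scalar extension to `k` of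
`ellAlgebra a`: the morphisms of superalgebras from the latter (which is totally even) to `A`. -/
structure PaPoint where
  hom : k ⊗[Za a] ellAlgebra a →ₐ[k] A
  hom_mem : ∀ r, hom r ∈ 𝒜 0

/-- For a point of `P_a` with `ℓ ↦ t`, the power `t^z`, that is, the image of `ℓ^z`. -/
def PaPoint.pow [CharZero K] {𝒜 : ZMod 2 → Submodule k A} (t : PaPoint a 𝒜) (z : adjoinZ a) : A :=
  t.hom (1 ⊗ₜ ⟨ellPow a z, ellPow_mem z⟩)

/-- The subgroup `h_H^{[a]}(A)`, `H` in `𝔥_{ℤ[a]}`: the operators acting on every weight space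
`V_μ` as `t^{μ(H)}`, for a point `t` of `P_a(A)`. -/
def IsAdmissible.aTorusOneParam [CharZero K] (c : B.cartanLattice) : Set (hM.GL k A) :=
  {g | ∃ t : PaPoint a 𝒜,
    ∀ (μ : Cartan K →ₗ[K] K) (z : adjoinZ a), μ c = z → ∀ m : M, (m : V) ∈ weightSpace ρ μ →
      (g : Module.End A (hM.Points k A)) (1 ⊗ₜ (1 ⊗ₜ m)) = t.pow z ⊗ₜ (1 ⊗ₜ m)}

def IsAdmissible.G₀' : Subgroup (hM.GL k A) :=
  Subgroup.closure ((⋃ c, hM.torusOneParam 𝒜 c) ∪ ⋃ α, hM.evenOneParam 𝒜 α)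

def IsAdmissible.T' : Subgroup (hM.GL k A) :=
  Subgroup.closure (⋃ c, hM.torusOneParam 𝒜 c)

def IsAdmissible.T [CharZero K] : Subgroup (hM.GL k A) :=
  Subgroup.closure ((⋃ c, hM.aTorusOneParam 𝒜 c) ∪ hM.T' 𝒜)

def IsAdmissible.G₀ [CharZero K] : Subgroup (hM.GL k A) :=
  Subgroup.closure ((hM.G₀' 𝒜 : Set (hM.GL k A)) ∪ hM.T 𝒜)

/-- The group `G(A)` of `A`-points of the Chevalley supergroup functor. -/
def IsAdmissible.G [CharZero K] : Subgroup (hM.GL k A) :=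
  Subgroup.closure ((hM.G₀ 𝒜 : Set (hM.GL k A)) ∪ ⋃ γ, hM.oddOneParam 𝒜 γ)

/-- Products of finitely many elements of the odd one-parameter subgroups. -/
def IsAdmissible.G₁ : Set (hM.GL k A) :=
  Submonoid.closure (⋃ γ, hM.oddOneParam 𝒜 γ)

/-- `G₀⁺(A)` for `s = 1` and `G₀⁻(A)` for `s = -1`: finite products of elements `x_α(t)` with `α` even
of sign `s`. -/
def IsAdmissible.G₀pm (s : ℤˣ) : Set (hM.GL k A) :=
  Submonoid.closure (⋃ α, ⋃ (_ : α.1 ∈ evenRoots s), hM.evenOneParam 𝒜 α)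

/-- `G₁⁺(A)` for `s = 1` and `G₁⁻(A)` for `s = -1`. -/
def IsAdmissible.G₁pm (s : ℤˣ) : Set (hM.GL k A) :=
  Submonoid.closure (⋃ γ, ⋃ (_ : γ.1 ∈ oddRoots s), hM.oddOneParam 𝒜 γ)

/-- `G⁺(A)` for `s = 1` and `G⁻(A)` for `s = -1`. -/
def IsAdmissible.Gpm (s : ℤˣ) : Set (hM.GL k A) :=
  Submonoid.closure ((⋃ α, ⋃ (_ : α.1 ∈ evenRoots s), hM.evenOneParam 𝒜 α) ∪
    ⋃ γ, ⋃ (_ : γ.1 ∈ oddRoots s), hM.oddOneParam 𝒜 γ)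

/-- `G₁^<(A)` for the total order on the eight odd roots given by their enumeration `e`: the products
`x_{γ₁}(ϑ₁) ⋯ x_{γ₈}(ϑ₈)` in increasing order. -/
def IsAdmissible.G₁ord (e : Fin 8 ≃ roots₁) : Set (hM.GL k A) :=
  {g | ∃ ϑ : Fin 8 → A, (∀ i, ϑ i ∈ 𝒜 1) ∧
    (g : Module.End A (hM.Points k A)) = (List.ofFn fun i => hM.xOdd k (e i) (ϑ i)).prod}

end Supergroup
end SuperD21

end

open SuperD21
open scoped Pointwise

/-!
The group `G₀(A)` normalizes the group `C` generated by the odd one-parameter subgroups: a toral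
element rescales the parameter of `x_γ(ϑ)`, and `x_α(t) x_γ(ϑ) = x_γ(ϑ) x_{α+γ}(c ϑ t) x_α(t)`
because `ad X_α` has square zero on the odd part. This gives (a), and (b) as well since `α + γ` has
the sign of `α` and `γ` when these agree.

For (c) it remains to show `C ⊆ P G₀(A)` for the ordered product `P` of the odd one-parameter
subgroups. An element of `C` involves finitely many odd parameters; as these anticommute and square
to zero, products of many of them vanish. Commutators of odd elements `x_γ(ϑ)`, `x_δ(η)` are
`1 + c ϑ η f` with `f` the action of `X_{γ+δ}` or `H_γ`, and commutators of those with odd elements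
are again odd, so moving a factor into its place only costs commutators of higher degree in the
parameters, and downward induction on the degree applies. The factors `1 + d H_γ` with `d² = 0` lie
in `G₀(A)` because `ℓ ↦ 1 + d` extends to the point `ℓ^z ↦ 1 + z d` of `P_a(A)`.
-/

noncomputable section

namespace SuperD21

open TensorProduct LieSuperalgebra

section Groups
open scoped commutatorElement

lemma coe_submonoid_sup_of_mul_comm {M : Type*} [Monoid M] {P Q : Submonoid M}
    (h : (P : Set M) * Q = Q * P) : ((P ⊔ Q : Submonoid M) : Set M) = (P : Set M) * Q := by
  have hmul : (P : Set M) * Q * ((P : Set M) * Q) = (P : Set M) * Q := by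
    rw [mul_assoc, ← mul_assoc (Q : Set M), ← h, mul_assoc (P : Set M), Submonoid.coe_mul_self_eq,
      ← mul_assoc, Submonoid.coe_mul_self_eq]
  let R : Submonoid M :=
    { carrier := (P : Set M) * Q
      one_mem' := ⟨1, one_mem P, 1, one_mem Q, one_mul 1⟩
      mul_mem' := fun hx hy => hmul ▸ Set.mul_mem_mul hx hy }
  have hsup : P ⊔ Q ≤ R := sup_le (fun x hx => ⟨x, hx, 1, one_mem Q, mul_one x⟩)
    fun x hx => ⟨1, one_mem P, x, hx, one_mul x⟩
  refine Set.Subset.antisymm hsup ?_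
  rintro _ ⟨p, hp, q, hq, rfl⟩
  exact Submonoid.mul_mem_sup hp hq

variable {G : Type*} [Group G]

lemma coe_submonoidClosure_eq_subgroupClosure {S : Set G} (hS : S⁻¹ ⊆ S) :
    (Submonoid.closure S : Set G) = Subgroup.closure S := by
  rw [← Subgroup.coe_toSubmonoid, Subgroup.closure_toSubmonoid,
    Set.union_eq_self_of_subset_right hS]

lemma submonoidClosure_mul_comm {E S : Set G} (hS : S⁻¹ ⊆ S)
    (hE : E ⊆ Subgroup.normalizer (Subgroup.closure S : Set G)) :
    (Submonoid.closure E : Set G) * (Submonoid.closure S : Set G) =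
      (Submonoid.closure S : Set G) * (Submonoid.closure E : Set G) := by
  rw [coe_submonoidClosure_eq_subgroupClosure hS]
  exact Subgroup.set_mul_normalizer_comm _ _ <|
    (Submonoid.closure_le (S := (Subgroup.normalizer _).toSubmonoid)).2 hE

lemma mem_normalizer_closure {S : Set G} {g : G}
    (hg : ∀ s ∈ S, g * s * g⁻¹ ∈ Subgroup.closure S)
    (hg' : ∀ s ∈ S, g⁻¹ * s * g ∈ Subgroup.closure S) :
    g ∈ Subgroup.normalizer (Subgroup.closure S : Set G) := by
  have hconj {x : G} (hx : ∀ s ∈ S, x * s * x⁻¹ ∈ Subgroup.closure S) :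
      Subgroup.closure S ≤ (Subgroup.closure S).comap (MulAut.conj x).toMonoidHom :=
    (Subgroup.closure_le _).2 hx
  refine Subgroup.mem_normalizer_iff.2 fun n => ⟨fun hn => hconj hg hn, fun hn => ?_⟩
  simpa [mul_assoc] using hconj (x := g⁻¹) (by simpa using hg') hn

lemma mem_normalizer_closure_of_commute {S : Set G} {g : G}
    (h : ∀ s ∈ S, ∃ y ∈ Subgroup.closure S, Commute g y ∧ g * s = s * y * g) :
    g ∈ Subgroup.normalizer (Subgroup.closure S : Set G) := by
  refine mem_normalizer_closure (fun s hs => ?_) fun s hs => ?_ <;>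
    obtain ⟨y, hy, hgy, hgs⟩ := h s hs
  · rw [hgs, mul_inv_cancel_right]
    exact mul_mem (Subgroup.subset_closure hs) hy
  · have hs' : g⁻¹ * s * g = s * y⁻¹ := by
      rw [mul_assoc, inv_mul_eq_iff_eq_mul, ← mul_assoc, hgs, mul_assoc s, ← hgy.eq, mul_assoc,
        mul_assoc, mul_inv_cancel, mul_one]
    exact hs' ▸ mul_mem (Subgroup.subset_closure hs) (inv_mem hy)

/-- The set of the products `p₁ p₂ ⋯` with factors in the successive members, indexed by the list
`l`, of a family of subgroups. -/
def orderedProd {ι : Type*} (P : ι → Subgroup G) (l : List ι) : Set G :=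
  (l.map fun i => (P i : Set G)).prod

section OrderedProd
variable {ι : Type*} {P Q : ι → Subgroup G}

lemma one_mem_orderedProd (l : List ι) : 1 ∈ orderedProd P l := by
  induction l with
  | nil => exact Set.mem_one.2 rfl
  | cons i l ih => exact ⟨1, one_mem (P i), 1, ih, one_mul 1⟩

lemma orderedProd_mono (h : P ≤ Q) (l : List ι) : orderedProd P l ⊆ orderedProd Q l :=
  List.prod_le_prod' fun i _ => h i

lemma inv_orderedProd (l : List ι) : (orderedProd P l)⁻¹ = orderedProd P l.reverse := by
  unfold orderedProd
  induction l with
  | nil => simp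
  | cons i l ih => simp [mul_inv_rev, ih]

lemma orderedProd_subset {C : Subgroup G} (h : ∀ i, P i ≤ C) (l : List ι) :
    orderedProd P l ⊆ C := by
  induction l with
  | nil => simp [orderedProd]
  | cons i l ih =>
    rintro _ ⟨p, hp, w, hw, rfl⟩
    exact mul_mem (h i hp) (ih hw)

end OrderedProd

/-- A filtration of a group by generating sets, shifted by commutators with the subgroups `P i`, all
of whose members lie in `H` or in one of the `P i`. -/
structure IsCommutatorFiltration {ι : Type*} (H : Subgroup G) (P : ι → Subgroup G)
    (S : ℕ → Set G) : Prop where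
  antitone : Antitone S
  inv_subset : ∀ m, (S m)⁻¹ ⊆ S m
  mem_or_exists_mem : ∀ {m q}, q ∈ S m → q ∈ H ∨ ∃ i, q ∈ P i
  commutator_mem : ∀ {m i p q}, p ∈ P i → q ∈ S m → ⁅q, p⁆ ∈ Subgroup.closure (S (m + 1))

namespace IsCommutatorFiltration
variable {ι : Type*} {H : Subgroup G} {P : ι → Subgroup G} {S : ℕ → Set G}

lemma le_normalizer (hS : IsCommutatorFiltration H P S) (i : ι) (m : ℕ) :
    P i ≤ Subgroup.normalizer (Subgroup.closure (S m) : Set G) := by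
  refine Subgroup.le_normalizer_closure_iff.2 fun p hp q hq => ?_
  have hcomm : ⁅q, p⁆⁻¹ ∈ Subgroup.closure (S m) :=
    inv_mem (Subgroup.closure_mono (hS.antitone m.le_succ) (hS.commutator_mem hp hq))
  simpa [commutatorElement_def, mul_assoc] using mul_mem hcomm (Subgroup.subset_closure hq)

lemma exists_mul_mul_eq (hS : IsCommutatorFiltration H P S) {m : ℕ} {i : ι} {p q w x n : G}
    (hp : p ∈ P i) (hq : q ∈ S m) (hn : n ∈ Subgroup.closure (S (m + 1))) (hqw : q * w = n * x) :
    ∃ n' ∈ Subgroup.closure (S (m + 1)), q * (p * w) = n' * (p * x) := by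
  refine ⟨⁅q, p⁆ * (p * n * p⁻¹), mul_mem (hS.commutator_mem hp hq)
    ((Subgroup.mem_normalizer_iff.1 (hS.le_normalizer i _ hp) n).1 hn), ?_⟩
  calc q * (p * w) = ⁅q, p⁆ * p * (q * w) := by simp [commutatorElement_def, mul_assoc]
    _ = ⁅q, p⁆ * (p * n * p⁻¹) * (p * x) := by rw [hqw]; group

lemma exists_mul_list_prod_eq (hS : IsCommutatorFiltration H P S) {m : ℕ} {q : G} (hq : q ∈ S m)
    {l : List ι} {w : G} (hw : w ∈ orderedProd P l) :
    ∃ n ∈ Subgroup.closure (S (m + 1)), q * w = n * (w * q) := by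
  induction l generalizing w with
  | nil => exact ⟨1, one_mem _, by simp [Set.mem_one.1 hw]⟩
  | cons i l ih =>
    obtain ⟨p, hp, w, hw, rfl⟩ := hw
    obtain ⟨n, hn, hqw⟩ := ih hw
    simpa only [mul_assoc] using hS.exists_mul_mul_eq hp hq hn hqw

lemma exists_mul_list_prod_eq_of_mem (hS : IsCommutatorFiltration H P S) {m : ℕ} {q : G}
    (hq : q ∈ S m) {l : List ι} {i : ι} (hi : i ∈ l) (hqi : q ∈ P i) {w : G}
    (hw : w ∈ orderedProd P l) :
    ∃ n ∈ Subgroup.closure (S (m + 1)), ∃ w' ∈ orderedProd P l,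
      q * w = n * w' := by
  induction l generalizing w with
  | nil => simp at hi
  | cons j l ih =>
    obtain ⟨p, hp, w, hw, rfl⟩ := hw
    rcases List.mem_cons.1 hi with rfl | hi
    · exact ⟨1, one_mem _, q * p * w, ⟨q * p, mul_mem hqi hp, w, hw, rfl⟩, by group⟩
    · obtain ⟨n, hn, w', hw', hqw⟩ := ih hi hw
      obtain ⟨n', hn', hqpw⟩ := hS.exists_mul_mul_eq hp hq hn hqw
      exact ⟨n', hn', p * w', ⟨p, hp, w', hw', rfl⟩, hqpw⟩

theorem closure_le_stabilizer (hS : IsCommutatorFiltration H P S) {N : ℕ} (hN : S N ⊆ {1})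
    {l : List ι} (hl : ∀ i, i ∈ l) {m : ℕ} (hm : m ≤ N) :
    Subgroup.closure (S m) ≤
      MulAction.stabilizer G (orderedProd P l * (H : Set G)) := by
  induction hm using Nat.decreasingInduction with
  | self => exact (Subgroup.closure_eq_bot_iff.2 hN).trans_le bot_le
  | of_succ m _ ih =>
    have hstable (q : G) (hq : q ∈ S m) :
        q • (orderedProd P l * (H : Set G)) ⊆
          orderedProd P l * (H : Set G) := by
      rintro _ ⟨_, ⟨w, hw, h, hh, rfl⟩, rfl⟩
      obtain ⟨n, hn, w', hw', h', hh', hqwh⟩ : ∃ n ∈ Subgroup.closure (S (m + 1)),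
          ∃ w' ∈ orderedProd P l, ∃ h' ∈ H, q * (w * h) = n * (w' * h') := by
        rcases hS.mem_or_exists_mem hq with hqH | ⟨i, hqi⟩
        · obtain ⟨n, hn, hqw⟩ := hS.exists_mul_list_prod_eq hq hw
          exact ⟨n, hn, w, hw, q * h, mul_mem hqH hh, by rw [← mul_assoc, hqw]; group⟩
        · obtain ⟨n, hn, w', hw', hqw⟩ := hS.exists_mul_list_prod_eq_of_mem hq (hl i) hqi hw
          exact ⟨n, hn, w', hw', h, hh, by rw [← mul_assoc, hqw, mul_assoc]⟩
      change q * (w * h) ∈ _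
      rw [hqwh]
      exact (MulAction.mem_stabilizer_set.1 (ih hn) _).2 ⟨w', hw', h', hh', rfl⟩
    exact (Subgroup.closure_le _).2 fun q hq => (hstable q hq).antisymm <|
      Set.subset_smul_set_iff.2 (hstable _ (hS.inv_subset m (Set.inv_mem_inv.2 hq)))

end IsCommutatorFiltration

end Groups

section Supercommutative
variable {k A : Type*} [CommRing k] [Ring A] [Algebra k A] {𝒜 : ZMod 2 → Submodule k A}

lemma koszul_zero_left (j : ZMod 2) : koszul 0 j = 1 := by revert j; decide

lemma koszul_one_one : koszul 1 1 = -1 := by decide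

lemma commute_of_mem_even [GradedAlgebra 𝒜] (h𝒜 : IsSupercommutative 𝒜) {t : A} (ht : t ∈ 𝒜 0)
    (x : A) : Commute t x := by
  induction x using DirectSum.Decomposition.inductionOn 𝒜 with
  | zero => exact Commute.zero_right t
  | homogeneous x => simpa [commute_iff_eq, koszul_zero_left] using h𝒜 _ _ t ht x x.2
  | add x y hx hy => exact hx.add_right hy

lemma mul_eq_neg_mul_of_mem_odd (h𝒜 : IsSupercommutative 𝒜) {x y : A} (hx : x ∈ 𝒜 1)
    (hy : y ∈ 𝒜 1) : x * y = -(y * x) := by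
  simpa [koszul_one_one] using h𝒜 1 1 x hx y hy

lemma mul_self_eq_zero_of_mem_odd (h𝒜 : IsSupercommutative 𝒜) (hA2 : ∀ x : A, 2 * x = 0 → x = 0)
    {x : A} (hx : x ∈ 𝒜 1) : x * x = 0 :=
  hA2 _ <| by rw [two_mul, ← eq_neg_iff_add_eq_zero, ← mul_eq_neg_mul_of_mem_odd h𝒜 hx hx]

lemma mul_mul_self_eq_zero_of_mem_odd (h𝒜 : IsSupercommutative 𝒜)
    (hsq : ∀ x ∈ 𝒜 1, x * x = 0) {x y : A} (hx : x ∈ 𝒜 1) (hy : y ∈ 𝒜 1) :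
    x * y * (x * y) = 0 := by
  rw [mul_assoc, ← mul_assoc y, mul_eq_neg_mul_of_mem_odd h𝒜 hy hx, neg_mul, mul_assoc, hsq y hy,
    mul_zero, neg_zero, mul_zero]

lemma mul_mem_even [GradedAlgebra 𝒜] {x y : A} (hx : x ∈ 𝒜 1) (hy : y ∈ 𝒜 1) : x * y ∈ 𝒜 0 :=
  SetLike.GradedMul.mul_mem (i := (1 : ZMod 2)) (j := 1) hx hy

lemma mul_mem_odd [GradedAlgebra 𝒜] {x t : A} (hx : x ∈ 𝒜 1) (ht : t ∈ 𝒜 0) : x * t ∈ 𝒜 1 :=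
  SetLike.GradedMul.mul_mem (i := (1 : ZMod 2)) (j := 0) hx ht

end Supercommutative

section ProdFiltration
variable {k A : Type*} [CommRing k] [Ring A] [Algebra k A]

/-- The filtration of `A` by degree in the elements of `S`: the `m`-th term is spanned by the
products of at least `m` elements of `S`. -/
def prodFiltration (k : Type*) {A : Type*} [CommRing k] [Ring A] [Algebra k A] (S : Set A) (m : ℕ) :
    Submodule k A :=
  Submodule.span k {x | ∃ l : List A, (∀ y ∈ l, y ∈ S) ∧ m ≤ l.length ∧ l.prod = x}

lemma prodFiltration_antitone (S : Set A) : Antitone (prodFiltration k S) := fun _ _ h =>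
  Submodule.span_mono fun _ ⟨l, hl, hlen, hprod⟩ => ⟨l, hl, h.trans hlen, hprod⟩

lemma prodFiltration_mono {S T : Set A} (h : S ⊆ T) (m : ℕ) :
    prodFiltration k S m ≤ prodFiltration k T m :=
  Submodule.span_mono fun _ ⟨l, hl, hlen, hprod⟩ => ⟨l, fun y hy => h (hl y hy), hlen, hprod⟩

lemma subset_prodFiltration_one (S : Set A) : S ⊆ prodFiltration k S 1 := fun x hx =>
  Submodule.subset_span ⟨[x], by simpa using hx, by simp, by simp⟩

lemma mul_mem_prodFiltration {S : Set A} {m n : ℕ} {x y : A} (hx : x ∈ prodFiltration k S m)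
    (hy : y ∈ prodFiltration k S n) : x * y ∈ prodFiltration k S (m + n) := by
  have hxy := Submodule.mul_mem_mul hx hy
  rw [prodFiltration, prodFiltration, Submodule.span_mul_span] at hxy
  refine Submodule.span_mono ?_ hxy
  rintro _ ⟨_, ⟨l, hl, hlen, rfl⟩, _, ⟨l', hl', hlen', rfl⟩, rfl⟩
  exact ⟨l ++ l', fun y hy => (List.mem_append.1 hy).elim (hl y) (hl' y),
    by rw [List.length_append]; exact add_le_add hlen hlen', by simp⟩

variable {S : Set A} (hsq : ∀ x ∈ S, x * x = 0) (hneg : ∀ x ∈ S, ∀ y ∈ S, x * y = -(y * x))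
include hsq hneg

lemma mul_list_prod_eq_zero_of_mem {x : A} {l : List A} (hl : ∀ y ∈ l, y ∈ S) (hx : x ∈ l) :
    x * l.prod = 0 := by
  induction l with
  | nil => simp at hx
  | cons y l ih =>
    rw [List.prod_cons, ← mul_assoc]
    rcases List.mem_cons.1 hx with rfl | hxl
    · rw [hsq x (hl x hx), zero_mul]
    · rw [hneg x (hl x hx) y (hl y List.mem_cons_self), neg_mul, mul_assoc,
        ih (fun z hz => hl z (List.mem_cons_of_mem y hz)) hxl, mul_zero, neg_zero]

lemma list_prod_eq_zero_of_not_nodup {l : List A} (hl : ∀ y ∈ l, y ∈ S) (hdup : ¬ l.Nodup) :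
    l.prod = 0 := by
  induction l with
  | nil => simp at hdup
  | cons y l ih =>
    have hl' : ∀ z ∈ l, z ∈ S := fun z hz => hl z (List.mem_cons_of_mem y hz)
    rw [List.prod_cons]
    by_cases hy : y ∈ l
    · exact mul_list_prod_eq_zero_of_mem hsq hneg hl' hy
    · rw [ih hl' fun hnodup => hdup (List.nodup_cons.2 ⟨hy, hnodup⟩), mul_zero]

lemma prodFiltration_eq_bot (hfin : S.Finite) : prodFiltration k S (S.ncard + 1) = ⊥ := by
  classical
  rw [eq_bot_iff, prodFiltration, Submodule.span_le]
  rintro _ ⟨l, hl, hlen, rfl⟩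
  refine list_prod_eq_zero_of_not_nodup hsq hneg hl fun hnodup => ?_
  have hcard : l.toFinset.card ≤ S.ncard := by
    rw [← Set.ncard_coe_finset]
    exact Set.ncard_le_ncard (fun y hy => hl y (by simpa using hy)) hfin
  rw [List.toFinset_card_of_nodup hnodup] at hcard
  omega

end ProdFiltration

section RingIdentities
variable {R : Type*} [Ring R]

/-- The unit `1 + x`, for `x` of square zero. -/
def oneAddUnit (x : R) (hx : x * x = 0) : Rˣ where
  val := 1 + x
  inv := 1 - x
  val_inv := by rw [mul_sub, add_mul, add_mul, hx]; simp
  inv_val := by rw [sub_mul, mul_add, mul_add, hx]; simp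

lemma one_add_mul_one_add_of_mul_eq_zero {x y : R} (h : x * y = 0) :
    (1 + x) * (1 + y) = 1 + (x + y) := by
  rw [add_mul, mul_add, mul_add, h]; simp [add_comm y, add_assoc]

lemma one_add_mul_one_add_eq {x y z : R} (h : x * y = y * x + z) (hx : z * x = 0)
    (hy : z * y = 0) : (1 + x) * (1 + y) = (1 + z) * ((1 + y) * (1 + x)) := by
  have hprod : z * ((1 + y) * (1 + x)) = z := by
    rw [← mul_assoc, mul_add z, hy, mul_one, add_zero, mul_add, hx, mul_one, add_zero]
  rw [add_mul 1 z, one_mul, hprod]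
  simp only [add_mul, mul_add, h, one_mul, mul_one]
  abel

lemma pow_succ_mul_of_commute {x y z : R} (h : x * y = y * x + z) (hz : Commute x z) (n : ℕ) :
    x ^ (n + 1) * y = y * x ^ (n + 1) + (n + 1 : ℕ) • (z * x ^ n) := by
  induction n with
  | zero => simp [h]
  | succ n ih =>
    have hxz : x * (z * x ^ n) = z * x ^ (n + 1) := by
      rw [← mul_assoc, hz.eq, mul_assoc, ← pow_succ']
    rw [pow_succ' x (n + 1), mul_assoc, ih, mul_add, ← mul_assoc x y, h, mul_smul_comm, hxz,
      succ_nsmul _ (n + 1), add_mul, mul_assoc]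
    abel

lemma sum_range_mul_one_add {F : ℕ → R} {y z : R} (h0 : Commute (F 0) y)
    (h : ∀ n, F (n + 1) * y = y * F (n + 1) + z * F n) (hyz : y * z = 0) {N : ℕ} (hN : F N = 0) :
    (∑ n ∈ Finset.range N, F n) * (1 + y) =
      (1 + y) * (1 + z) * ∑ n ∈ Finset.range N, F n := by
  have hsum : (∑ n ∈ Finset.range (N + 1), F n) * y =
      y * (∑ n ∈ Finset.range (N + 1), F n) + z * ∑ n ∈ Finset.range N, F n := by
    rw [Finset.sum_range_succ', add_mul, Finset.sum_mul, h0.eq]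
    simp only [h, Finset.sum_add_distrib, mul_add, Finset.mul_sum]
    abel
  rw [Finset.sum_range_succ, hN, add_zero] at hsum
  rw [mul_add, mul_one, hsum, one_add_mul_one_add_of_mul_eq_zero hyz, add_mul, add_mul, one_mul]

-- If the sum is not finite, then `finsum` is `0` on both sides.
lemma finsum_mul_one_add {F : ℕ → R} {y z : R} (h0 : Commute (F 0) y)
    (h : ∀ n, F (n + 1) * y = y * F (n + 1) + z * F n) (hyz : y * z = 0) :
    (∑ᶠ n, F n) * (1 + y) = (1 + y) * (1 + z) * ∑ᶠ n, F n := by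
  by_cases hF : (Function.support F).Finite
  · obtain ⟨N, hN⟩ := hF.bddAbove
    rw [finsum_eq_sum_of_support_subset (s := Finset.range (N + 1)) F fun n hn => by
      simpa using Nat.lt_succ_of_le (hN hn)]
    exact sum_range_mul_one_add h0 h hyz <| by_contra fun hne => N.not_succ_le_self (hN hne)
  · rw [finsum_of_infinite_support hF, zero_mul, mul_zero]

end RingIdentities

section TensorOp
variable {R : Type*} [CommRing R] {M : Type*} [AddCommGroup M] [Module R M]
  (k : Type*) [CommRing k] [Algebra R k] {A : Type*} [Ring A] [Algebra k A]

/-- The operator `b ⊗ (1 ⊗ v) ↦ b c ⊗ (1 ⊗ f v)` on `A ⊗_k (k ⊗_R M)`, biadditive in `c` and `f`.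
Right multiplication by `c` makes it linear over the noncommutative ring `A`. -/
def tensorOp : A →+ Module.End R M →+ Module.End A (A ⊗[k] (k ⊗[R] M)) where
  toFun c := AddMonoidHom.mk'
    (fun f => (AlgebraTensorModule.map (LinearMap.toSpanSingleton A A c) (f.baseChange k) :
      Module.End A (A ⊗[k] (k ⊗[R] M))))
    fun f g => by rw [LinearMap.baseChange_add, AlgebraTensorModule.map_add_right]
  map_zero' := AddMonoidHom.ext fun f => AlgebraTensorModule.ext fun x y => by simp
  map_add' c d := AddMonoidHom.ext fun f => by
    simp [LinearMap.toSpanSingleton_add, AlgebraTensorModule.map_add_left]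

variable {k}

lemma tensorOp_tmul (c b : A) (f : Module.End R M) (v : M) :
    tensorOp k c f (b ⊗ₜ (1 ⊗ₜ v)) = (b * c) ⊗ₜ (1 ⊗ₜ f v) := by
  simp [tensorOp]

lemma tensorEnd_ext {φ ψ : Module.End A (A ⊗[k] (k ⊗[R] M))}
    (h : ∀ m : M, φ (1 ⊗ₜ (1 ⊗ₜ m)) = ψ (1 ⊗ₜ (1 ⊗ₜ m))) : φ = ψ := by
  ext x
  change φ (1 ⊗ₜ x) = ψ (1 ⊗ₜ x)
  induction x using TensorProduct.induction_on with
  | zero => simp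
  | add x y hx hy => rw [tmul_add, map_add, map_add, hx, hy]
  | tmul r m =>
    have hrm : (1 : A) ⊗ₜ[k] (r ⊗ₜ[R] m) = (r • 1 : A) • (1 ⊗ₜ[k] (1 ⊗ₜ[R] m)) := by
      rw [smul_tmul', smul_eq_mul, mul_one, smul_tmul, smul_tmul', smul_eq_mul, mul_one]
    rw [hrm, map_smul, map_smul, h]

lemma tensorEnd_ext_of_closure_eq_top {φ ψ : Module.End A (A ⊗[k] (k ⊗[R] M))} {S : Set M}
    (hS : AddSubgroup.closure S = ⊤)
    (h : ∀ m ∈ S, φ (1 ⊗ₜ (1 ⊗ₜ m)) = ψ (1 ⊗ₜ (1 ⊗ₜ m))) : φ = ψ := by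
  let ι : M →+ A ⊗[k] (k ⊗[R] M) :=
    (TensorProduct.mk k A (k ⊗[R] M) 1).toAddMonoidHom.comp
      (TensorProduct.mk R k M 1).toAddMonoidHom
  have hι : φ.toAddMonoidHom.comp ι = ψ.toAddMonoidHom.comp ι :=
    AddMonoidHom.eq_of_eqOn_dense hS h
  exact tensorEnd_ext fun m => DFunLike.congr_fun hι m

lemma tensorOp_mul (c d : A) (f g : Module.End R M) :
    tensorOp k c f * tensorOp k d g = tensorOp k (d * c) (f * g) :=
  tensorEnd_ext fun m => by simp only [Module.End.mul_apply, tensorOp_tmul, one_mul]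

lemma tensorOp_one : tensorOp k (1 : A) (1 : Module.End R M) = 1 :=
  tensorEnd_ext fun m => by simp only [Module.End.one_apply, tensorOp_tmul, one_mul]

lemma tensorOp_smul (c : A) (r : R) (f : Module.End R M) :
    tensorOp k c (r • f) = tensorOp k (algebraMap R k r • c) f :=
  tensorEnd_ext fun m => by
    rw [tensorOp_tmul, tensorOp_tmul, one_mul, one_mul, LinearMap.smul_apply, tmul_smul,
      smul_tmul, algebraMap_smul]

lemma tensorOp_zsmul (n : ℤ) (c : A) (f : Module.End R M) :
    tensorOp k c (n • f) = tensorOp k (n • c) f :=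
  tensorEnd_ext fun m => by
    rw [tensorOp_tmul, tensorOp_tmul, one_mul, one_mul, LinearMap.smul_apply, tmul_smul, tmul_smul,
      smul_tmul']

lemma tensorOp_mul_eq_zero {c d : A} (h : d * c = 0) (f g : Module.End R M) :
    tensorOp k c f * tensorOp k d g = 0 := by
  rw [tensorOp_mul, h, map_zero, AddMonoidHom.zero_apply]

lemma one_add_tensorOp_mul {f g h : Module.End R M} {c : R} {s : ℤ} (hs : s * s = 1)
    (hfg : f * g = s • (g * f) + c • h) {d ϑ : A} (hϑd : ϑ * d = s • (d * ϑ)) (hd : d * d = 0)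
    (hϑ : ϑ * ϑ = 0) :
    (1 + tensorOp k d f) * (1 + tensorOp k ϑ g) =
      (1 + tensorOp k (algebraMap R k c • (ϑ * d)) h) *
        ((1 + tensorOp k ϑ g) * (1 + tensorOp k d f)) := by
  refine one_add_mul_one_add_eq (R := Module.End A (A ⊗[k] (k ⊗[R] M))) ?_
    (tensorOp_mul_eq_zero ?_ _ _) (tensorOp_mul_eq_zero ?_ _ _)
  · rw [tensorOp_mul, tensorOp_mul, hfg, map_add, tensorOp_smul, tensorOp_zsmul, hϑd, smul_smul, hs,
      one_smul]
  · rw [hϑd, mul_smul_comm, mul_smul_comm, ← mul_assoc, hd, zero_mul, smul_zero, smul_zero]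
  · rw [mul_smul_comm, ← mul_assoc, hϑ, zero_mul, smul_zero]

lemma finsum_tensorOp_mul {D : ℕ → Module.End R M} {X Y : Module.End R M} {c : R} (h0 : D 0 = 1)
    (h : ∀ n, D (n + 1) * X = X * D (n + 1) + c • (Y * D n)) {t ϑ : A} (ht : Commute t ϑ)
    (hϑ : ϑ * ϑ = 0) :
    (∑ᶠ n, tensorOp k (t ^ n) (D n)) * (1 + tensorOp k ϑ X) =
      (1 + tensorOp k ϑ X) * (1 + tensorOp k (algebraMap R k c • (ϑ * t)) Y) *
        ∑ᶠ n, tensorOp k (t ^ n) (D n) := by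
  refine finsum_mul_one_add (R := Module.End A (A ⊗[k] (k ⊗[R] M))) ?_ (fun n => ?_)
    (tensorOp_mul_eq_zero ?_ _ _)
  · rw [h0, pow_zero, tensorOp_one]
    exact Commute.one_left _
  · rw [tensorOp_mul, tensorOp_mul, tensorOp_mul, h, map_add, tensorOp_smul, mul_smul_comm,
      ← mul_assoc, (ht.pow_left n).eq, mul_assoc ϑ, ← pow_succ, (ht.pow_left (n + 1)).eq]
  · rw [smul_mul_assoc, mul_assoc, ht.eq, ← mul_assoc, hϑ, zero_mul, smul_zero]

lemma finsum_tensorOp_of_sq_eq_zero {D : ℕ → Module.End R M} (h0 : D 0 = 1) {t : A}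
    (ht : t * t = 0) : ∑ᶠ n, tensorOp k (t ^ n) (D n) = 1 + tensorOp k t (D 1) := by
  rw [finsum_eq_sum_of_support_subset (s := Finset.range 2), Finset.sum_range_succ,
    Finset.sum_range_one, h0, pow_zero, pow_one, tensorOp_one]
  intro n hn
  by_contra hn2
  obtain ⟨m, rfl⟩ : ∃ m, n = 2 + m := Nat.exists_eq_add_of_le <|
    not_lt.1 (mt Finset.mem_range.2 hn2)
  exact hn (by simp only [pow_add, pow_two, ht, zero_mul, map_zero, AddMonoidHom.zero_apply])

end TensorOp

section OddSystem
open scoped commutatorElement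
variable {R : Type*} [CommRing R] {M : Type*} [AddCommGroup M] [Module R M]
  (k : Type*) [CommRing k] [Algebra R k] {A : Type*} [Ring A] [Algebra k A]

lemma val_commutatorElement_eq {S : Type*} [Monoid S] {p q : Sˣ} {z : S}
    (h : (q : S) * p = z * (p * q)) : ((⁅q, p⁆ : Sˣ) : S) = z := by
  rw [commutatorElement_def, Units.val_mul, Units.val_mul, Units.val_mul, h, ← mul_assoc z,
    Units.mul_inv_cancel_right, Units.mul_inv_cancel_right]

/-- The group of `A`-linear automorphisms of `A ⊗_k (k ⊗_R M)`. -/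
abbrev TensorGL (R M k A : Type*) [CommRing R] [AddCommGroup M] [Module R M] [CommRing k]
    [Algebra R k] [Ring A] [Algebra k A] : Type _ :=
  (Module.End A (A ⊗[k] (k ⊗[R] M)))ˣ

/-- The group of the operators `1 + ϑ X` with `ϑ ∈ J`, for an operator `X` of square zero. -/
def oneParamSubgroup {X : Module.End R M} (hX : X * X = 0) (J : Submodule k A) :
    Subgroup (TensorGL R M k A) :=
  have hadd (ϑ η : A) : (1 + tensorOp k ϑ X) * (1 + tensorOp k η X) = 1 + tensorOp k (ϑ + η) X := by
    rw [one_add_mul_one_add_of_mul_eq_zero (R := Module.End A (A ⊗[k] (k ⊗[R] M)))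
      (by rw [tensorOp_mul, hX, map_zero]), map_add, AddMonoidHom.add_apply]
  { carrier := {g | ∃ ϑ ∈ J, (g : Module.End A (A ⊗[k] (k ⊗[R] M))) = 1 + tensorOp k ϑ X}
    one_mem' := ⟨0, zero_mem J, by simp⟩
    mul_mem' := by
      rintro g h ⟨ϑ, hϑ, hg⟩ ⟨η, hη, hh⟩
      exact ⟨ϑ + η, add_mem hϑ hη, by rw [Units.val_mul, hg, hh, hadd]⟩
    inv_mem' := by
      rintro g ⟨ϑ, hϑ, hg⟩
      exact ⟨-ϑ, neg_mem hϑ, Units.inv_eq_of_mul_eq_one_right (by rw [hg, hadd]; simp)⟩ }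

/-- The operators `1 + d f` with `f ∈ E` and `d ∈ J` of square zero. -/
def infinitesimals (E : Set (Module.End R M)) (J : Submodule k A) :
    Set (TensorGL R M k A) :=
  {g | ∃ f ∈ E, ∃ d ∈ J, d * d = 0 ∧
    (g : Module.End A (A ⊗[k] (k ⊗[R] M))) = 1 + tensorOp k d f}

variable {k}

lemma oneParamSubgroup_mono {X : Module.End R M} (hX : X * X = 0) {I J : Submodule k A}
    (h : I ≤ J) : oneParamSubgroup k hX I ≤ oneParamSubgroup k hX J :=
  fun _ ⟨ϑ, hϑ, hg⟩ => ⟨ϑ, h hϑ, hg⟩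

lemma infinitesimals_mono (E : Set (Module.End R M)) {I J : Submodule k A} (h : I ≤ J) :
    infinitesimals k E I ⊆ infinitesimals k E J :=
  fun _ ⟨f, hf, d, hd, hg⟩ => ⟨f, hf, d, h hd, hg⟩

lemma inv_mem_infinitesimals {E : Set (Module.End R M)} {J : Submodule k A}
    {g : TensorGL R M k A} (hg : g ∈ infinitesimals k E J) :
    g⁻¹ ∈ infinitesimals k E J := by
  obtain ⟨f, hf, d, hd, hd2, hg⟩ := hg
  refine ⟨f, hf, -d, neg_mem hd, by rw [neg_mul_neg, hd2], Units.inv_eq_of_mul_eq_one_right ?_⟩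
  rw [hg, one_add_mul_one_add_of_mul_eq_zero (R := Module.End A (A ⊗[k] (k ⊗[R] M)))
    (tensorOp_mul_eq_zero (by rw [neg_mul, hd2, neg_zero]) _ _), ← AddMonoidHom.add_apply,
    ← map_add]
  simp

/-- The relations satisfied by the action of a basis `X` of the odd part of a Lie superalgebra and
of a spanning set `E` of its even part: brackets are multiples of members of `X` and `E`. -/
structure IsOddSystem {Γ : Type*} (X : Γ → Module.End R M) (E : Set (Module.End R M)) : Prop where
  mul_self_eq_zero : ∀ γ, X γ * X γ = 0
  exists_odd_odd : ∀ γ δ, ∃ f ∈ E, ∃ c : R, X γ * X δ = -(X δ * X γ) + c • f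
  exists_even_odd : ∀ f ∈ E, ∀ γ, ∃ δ, ∃ c : R, f * X γ = X γ * f + c • X δ

namespace IsOddSystem
variable {Γ : Type*} {X : Γ → Module.End R M} {E : Set (Module.End R M)} (hX : IsOddSystem X E)
  (𝒜 : ZMod 2 → Submodule k A)

/-- The elements `1 + d f` and `x_γ(ϑ)` with parameters in `J`. -/
def generators (J : Submodule k A) : Set (TensorGL R M k A) :=
  infinitesimals k E (𝒜 0 ⊓ J) ∪ ⋃ γ, oneParamSubgroup k (hX.mul_self_eq_zero γ) (𝒜 1 ⊓ J)

/-- The subgroup generated by the elements `x_γ(ϑ)` with odd parameters in `J`. -/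
def oddClosure (J : Submodule k A) : Subgroup (TensorGL R M k A) :=
  Subgroup.closure (⋃ γ, oneParamSubgroup k (hX.mul_self_eq_zero γ) (𝒜 1 ⊓ J))

lemma generators_mono : Monotone (hX.generators 𝒜) := fun _ _ h =>
  Set.union_subset_union (infinitesimals_mono E (inf_le_inf_left _ h)) <|
    Set.iUnion_mono fun _ => oneParamSubgroup_mono _ (inf_le_inf_left _ h)

lemma oddClosure_mono : Monotone (hX.oddClosure 𝒜) := fun _ _ h =>
  Subgroup.closure_mono <| Set.iUnion_mono fun _ => oneParamSubgroup_mono _ (inf_le_inf_left _ h)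

lemma inv_generators_subset (J : Submodule k A) : (hX.generators 𝒜 J)⁻¹ ⊆ hX.generators 𝒜 J := by
  rintro g (hg | hg)
  · exact Or.inl (by simpa using inv_mem_infinitesimals hg)
  · simp only [Set.mem_iUnion, SetLike.mem_coe, inv_mem_iff] at hg
    exact Or.inr (Set.mem_iUnion.2 hg)

lemma generators_bot_subset : hX.generators 𝒜 ⊥ ⊆ {1} := by
  have hbot (i : ZMod 2) {d : A} (hd : d ∈ 𝒜 i ⊓ ⊥) : d = 0 := by simpa using hd
  rintro g (⟨f, -, d, hd, -, hg⟩ | hg)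
  · exact Units.ext (by simp [hg, hbot 0 hd])
  · obtain ⟨γ, ϑ, hϑ, hg⟩ := Set.mem_iUnion.1 hg
    exact Units.ext (by simp [hg, hbot 1 hϑ])

variable {𝒜} [GradedAlgebra 𝒜] (h𝒜 : IsSupercommutative 𝒜) (hsq : ∀ x ∈ 𝒜 1, x * x = 0)
include h𝒜 hsq

lemma commutator_infinitesimal_mem {I J J' : Submodule k A} (hJ : ∀ x ∈ I, ∀ y ∈ J, x * y ∈ J')
    {γ : Γ} {p q : TensorGL R M k A}
    (hp : p ∈ oneParamSubgroup k (hX.mul_self_eq_zero γ) (𝒜 1 ⊓ I))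
    (hq : q ∈ infinitesimals k E (𝒜 0 ⊓ J)) : ⁅q, p⁆ ∈ hX.generators 𝒜 J' := by
  obtain ⟨ϑ, ⟨hϑ, hϑI⟩, hp⟩ := hp
  obtain ⟨f, hf, d, ⟨hd, hdJ⟩, hd2, hq⟩ := hq
  obtain ⟨δ, c, hc⟩ := hX.exists_even_odd f hf γ
  refine Or.inr (Set.mem_iUnion.2 ⟨δ, algebraMap R k c • (ϑ * d), ⟨(𝒜 1).smul_mem _
    (mul_mem_odd hϑ hd), J'.smul_mem _ (hJ ϑ hϑI d hdJ)⟩, val_commutatorElement_eq ?_⟩)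
  rw [hp, hq]
  exact one_add_tensorOp_mul (one_mul (1 : ℤ)) (by rw [hc, one_smul])
    (by rw [one_smul, (commute_of_mem_even h𝒜 hd ϑ).eq]) hd2 (hsq ϑ hϑ)

lemma commutator_odd_mem {I J J' : Submodule k A} (hJ : ∀ x ∈ I, ∀ y ∈ J, x * y ∈ J') {γ δ : Γ}
    {p q : TensorGL R M k A}
    (hp : p ∈ oneParamSubgroup k (hX.mul_self_eq_zero γ) (𝒜 1 ⊓ I))
    (hq : q ∈ oneParamSubgroup k (hX.mul_self_eq_zero δ) (𝒜 1 ⊓ J)) :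
    ⁅q, p⁆ ∈ hX.generators 𝒜 J' := by
  obtain ⟨ϑ, ⟨hϑ, hϑI⟩, hp⟩ := hp
  obtain ⟨η, ⟨hη, hηJ⟩, hq⟩ := hq
  obtain ⟨f, hf, c, hc⟩ := hX.exists_odd_odd δ γ
  refine Or.inl ⟨f, hf, algebraMap R k c • (ϑ * η), ⟨(𝒜 0).smul_mem _ (mul_mem_even hϑ hη),
    J'.smul_mem _ (hJ ϑ hϑI η hηJ)⟩, ?_, val_commutatorElement_eq ?_⟩
  · rw [smul_mul_smul_comm, mul_mul_self_eq_zero_of_mem_odd h𝒜 hsq hϑ hη, smul_zero]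
  · rw [hp, hq]
    exact one_add_tensorOp_mul (s := -1) (by norm_num) (by rw [hc, neg_one_smul])
      (by rw [neg_one_smul, mul_eq_neg_mul_of_mem_odd h𝒜 hϑ hη]) (hsq η hη) (hsq ϑ hϑ)

variable {H : Subgroup (TensorGL R M k A)} (hH : infinitesimals k E (𝒜 0) ⊆ H)
include hH

lemma isCommutatorFiltration (S : Set A) :
    IsCommutatorFiltration H
      (fun γ => oneParamSubgroup k (hX.mul_self_eq_zero γ) (𝒜 1 ⊓ prodFiltration k S 1))
      (fun m => hX.generators 𝒜 (prodFiltration k S (m + 1))) where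
  antitone _ _ h := hX.generators_mono 𝒜 (prodFiltration_antitone S (Nat.add_le_add_right h 1))
  inv_subset m := hX.inv_generators_subset 𝒜 _
  mem_or_exists_mem := by
    rintro m q (hq | hq)
    · exact Or.inl (hH (infinitesimals_mono E inf_le_left hq))
    · obtain ⟨γ, hq⟩ := Set.mem_iUnion.1 hq
      exact Or.inr ⟨γ, oneParamSubgroup_mono _
        (inf_le_inf_left _ (prodFiltration_antitone S (Nat.le_add_left 1 m))) hq⟩
  commutator_mem := by
    rintro m γ p q hp hq
    have hmul : ∀ x ∈ prodFiltration k S 1, ∀ y ∈ prodFiltration k S (m + 1),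
        x * y ∈ prodFiltration k S (m + 1 + 1) := fun x hx y hy =>
      add_comm 1 (m + 1) ▸ mul_mem_prodFiltration hx hy
    refine Subgroup.subset_closure (hq.elim
      (hX.commutator_infinitesimal_mem h𝒜 hsq hmul hp) fun hq => ?_)
    obtain ⟨δ, hq⟩ := Set.mem_iUnion.1 hq
    exact hX.commutator_odd_mem h𝒜 hsq hmul hp hq

omit [GradedAlgebra 𝒜] h𝒜 hsq hH in
lemma exists_finite_of_mem_oddClosure {n : TensorGL R M k A}
    (hn : n ∈ hX.oddClosure 𝒜 ⊤) :
    ∃ S : Set A, S.Finite ∧ S ⊆ 𝒜 1 ∧ n ∈ hX.oddClosure 𝒜 (prodFiltration k S 1) := by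
  have hmono {S T : Set A} (h : S ⊆ T) :
      hX.oddClosure 𝒜 (prodFiltration k S 1) ≤ hX.oddClosure 𝒜 (prodFiltration k T 1) :=
    hX.oddClosure_mono 𝒜 (prodFiltration_mono h 1)
  induction hn using Subgroup.closure_induction with
  | mem g hg =>
    obtain ⟨γ, ϑ, hϑ, hg⟩ := Set.mem_iUnion.1 hg
    exact ⟨{ϑ}, Set.finite_singleton ϑ, Set.singleton_subset_iff.2 hϑ.1, Subgroup.subset_closure
      (Set.mem_iUnion.2 ⟨γ, ϑ, ⟨hϑ.1, subset_prodFiltration_one _ rfl⟩, hg⟩)⟩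
  | one => exact ⟨∅, Set.finite_empty, Set.empty_subset _, one_mem _⟩
  | mul g h _ _ hg hh =>
    obtain ⟨S, hS, hS1, hg⟩ := hg
    obtain ⟨T, hT, hT1, hh⟩ := hh
    exact ⟨S ∪ T, hS.union hT, Set.union_subset hS1 hT1,
      mul_mem (hmono Set.subset_union_left hg) (hmono Set.subset_union_right hh)⟩
  | inv g _ hg =>
    obtain ⟨S, hS, hS1, hg⟩ := hg
    exact ⟨S, hS, hS1, inv_mem hg⟩

lemma oddClosure_subset_mul {l : List Γ} (hl : ∀ γ, γ ∈ l) :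
    (hX.oddClosure 𝒜 ⊤ : Set (TensorGL R M k A)) ⊆
      orderedProd (fun γ => oneParamSubgroup k (hX.mul_self_eq_zero γ) (𝒜 1)) l *
        (H : Set (TensorGL R M k A)) := by
  intro n hn
  obtain ⟨S, hfin, hS, hn⟩ := hX.exists_finite_of_mem_oddClosure hn
  have hbot : hX.generators 𝒜 (prodFiltration k S (S.ncard + 1)) ⊆ {1} := by
    rw [prodFiltration_eq_bot (fun x hx => hsq x (hS hx))
      (fun x hx y hy => mul_eq_neg_mul_of_mem_odd h𝒜 (hS hx) (hS hy)) hfin]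
    exact hX.generators_bot_subset 𝒜
  have hstab := (hX.isCommutatorFiltration h𝒜 hsq hH S).closure_le_stabilizer hbot hl
    (Nat.zero_le _) (Subgroup.closure_mono Set.subset_union_right hn)
  have hn := (MulAction.mem_stabilizer_set.1 hstab 1).2
    ⟨1, one_mem_orderedProd l, 1, one_mem H, one_mul 1⟩
  rw [smul_eq_mul, mul_one] at hn
  exact Set.mul_subset_mul_right
    (orderedProd_mono (fun γ => oneParamSubgroup_mono _ inf_le_left) l) hn

theorem oddClosure_mul_eq {l : List Γ} (hl : ∀ γ, γ ∈ l) :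
    (hX.oddClosure 𝒜 ⊤ : Set (TensorGL R M k A)) * (H : Set (TensorGL R M k A)) =
      orderedProd (fun γ => oneParamSubgroup k (hX.mul_self_eq_zero γ) (𝒜 1)) l *
        (H : Set (TensorGL R M k A)) := by
  refine Set.Subset.antisymm ?_ (Set.mul_subset_mul_right (orderedProd_subset (fun γ p hp =>
    Subgroup.subset_closure (Set.mem_iUnion.2 ⟨γ, oneParamSubgroup_mono _ ?_ hp⟩)) l))
  · refine (Set.mul_subset_mul_right (hX.oddClosure_subset_mul h𝒜 hsq hH hl)).trans ?_
    rw [mul_assoc, coe_mul_coe]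
  · simp

theorem mul_oddClosure_eq {l : List Γ} (hl : ∀ γ, γ ∈ l) :
    (H : Set (TensorGL R M k A)) * (hX.oddClosure 𝒜 ⊤ : Set (TensorGL R M k A)) =
      (H : Set (TensorGL R M k A)) *
        orderedProd (fun γ => oneParamSubgroup k (hX.mul_self_eq_zero γ) (𝒜 1)) l := by
  have h := congrArg (·⁻¹) <| hX.oddClosure_mul_eq h𝒜 hsq hH (l := l.reverse) (by simpa using hl)
  simpa only [mul_inv_rev, inv_coe_set, inv_orderedProd, List.reverse_reverse] using h

end IsOddSystem
end OddSystem

section Roots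

lemma mem_roots₁ {γ : Fin 3 → ℤ} : γ ∈ roots₁ ↔ ∀ i, γ i = 1 ∨ γ i = -1 := by
  refine ⟨fun h => h.elim And.right And.right, fun h => ?_⟩
  exact (h 0).imp (fun h0 => ⟨by simpa using h0, h⟩) fun h0 => ⟨by simpa using h0, h⟩

lemma mem_roots₀ {α : Fin 3 → ℤ} :
    α ∈ roots₀ ↔ ∃ i, ∃ s : ℤˣ, α = Pi.single i (2 * (s : ℤ)) := by
  refine ⟨fun h => h.elim (fun ⟨i, h⟩ => ⟨i, 1, h⟩) fun ⟨i, h⟩ => ⟨i, -1, h⟩, ?_⟩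
  rintro ⟨i, s, h⟩
  rcases Int.units_eq_one_or s with rfl | rfl
  exacts [Or.inl ⟨i, h⟩, Or.inr ⟨i, h⟩]

lemma single_mem_roots₀ (i : Fin 3) : (Pi.single i 2 : Fin 3 → ℤ) ∈ roots₀ :=
  mem_roots₀.2 ⟨i, 1, by simp⟩

lemma even_apply_of_mem_roots₀ {α : Fin 3 → ℤ} (h : α ∈ roots₀) (j : Fin 3) : Even (α j) := by
  obtain ⟨i, s, rfl⟩ := mem_roots₀.1 h
  by_cases hij : j = i
  · subst hij; simp
  · simp [hij]

lemma odd_apply_of_mem_roots₁ {γ : Fin 3 → ℤ} (h : γ ∈ roots₁) (j : Fin 3) : Odd (γ j) := by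
  rcases mem_roots₁.1 h j with h | h <;> rw [h] <;> decide

lemma notMem_roots₁_of_mem_roots₀ {α : Fin 3 → ℤ} (h : α ∈ roots₀) : α ∉ roots₁ := fun h1 =>
  Int.not_even_iff_odd.2 (odd_apply_of_mem_roots₁ h1 0) (even_apply_of_mem_roots₀ h 0)

lemma mem_roots₁_of_odd_apply {γ : Fin 3 → ℤ} (h : γ ∈ roots) {j : Fin 3} (hj : Odd (γ j)) :
    γ ∈ roots₁ :=
  h.resolve_left fun h0 => Int.not_even_iff_odd.2 hj (even_apply_of_mem_roots₀ h0 j)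

lemma mem_roots₀_of_even_apply {γ : Fin 3 → ℤ} (h : γ ∈ roots) {j : Fin 3} (hj : Even (γ j)) :
    γ ∈ roots₀ :=
  h.resolve_right fun h0 => Int.not_even_iff_odd.2 (odd_apply_of_mem_roots₁ h0 j) hj

variable {α γ δ : Fin 3 → ℤ}

lemma odd_add_apply (hα : α ∈ roots₀) (hγ : γ ∈ roots₁) (j : Fin 3) : Odd ((α + γ) j) :=
  (even_apply_of_mem_roots₀ hα j).add_odd (odd_apply_of_mem_roots₁ hγ j)

lemma add_ne_zero_of_mem_roots (hα : α ∈ roots₀) (hγ : γ ∈ roots₁) : α + γ ≠ 0 := fun h => by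
  have hodd := odd_add_apply hα hγ 0
  rw [h] at hodd
  simp at hodd

lemma add_mem_roots₁ (hα : α ∈ roots₀) (hγ : γ ∈ roots₁) (h : α + γ ∈ roots) : α + γ ∈ roots₁ :=
  mem_roots₁_of_odd_apply h (odd_add_apply hα hγ 0)

lemma add_mem_roots₀ (hγ : γ ∈ roots₁) (hδ : δ ∈ roots₁) (h : γ + δ ∈ roots) : γ + δ ∈ roots₀ :=
  mem_roots₀_of_even_apply h
    ((odd_apply_of_mem_roots₁ hγ 0).add_odd (odd_apply_of_mem_roots₁ hδ 0))

lemma add_self_ne_zero (hγ : γ ∈ roots₁) : γ + γ ≠ 0 := fun h => by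
  have h0 := congrFun h 0
  have hγ0 := mem_roots₁.1 hγ 0
  simp only [Pi.add_apply, Pi.zero_apply] at h0
  omega

lemma add_self_notMem_roots (hγ : γ ∈ roots₁) : γ + γ ∉ roots := fun h => by
  obtain ⟨i, s, hs⟩ := mem_roots₀.1 (add_mem_roots₀ hγ hγ h)
  have hi := congrFun hs (i + 1)
  have hγi := mem_roots₁.1 hγ (i + 1)
  rw [Pi.single_eq_of_ne (by simp), Pi.add_apply] at hi
  omega

lemma apply_eq_neg_of_single_add_mem_roots₁ (hγ : γ ∈ roots₁) {i : Fin 3} {s : ℤˣ}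
    (h : Pi.single i (2 * (s : ℤ)) + γ ∈ roots₁) : γ i = -s := by
  have hi := mem_roots₁.1 h i
  have hγi := mem_roots₁.1 hγ i
  simp only [Pi.add_apply, Pi.single_eq_same] at hi
  rcases Int.isUnit_iff.1 s.isUnit with hs | hs <;> rw [hs] at hi ⊢ <;> omega

lemma add_add_notMem_roots (hα : α ∈ roots₀) (hγ : γ ∈ roots₁) (h : α + γ ∈ roots) :
    α + (α + γ) ∉ roots := fun h2 => by
  have h1 := add_mem_roots₁ hα hγ h
  have h2 := add_mem_roots₁ hα h1 h2
  obtain ⟨i, s, rfl⟩ := mem_roots₀.1 hα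
  have e1 := apply_eq_neg_of_single_add_mem_roots₁ hγ h1
  have e2 := apply_eq_neg_of_single_add_mem_roots₁ h1 h2
  simp only [Pi.add_apply, Pi.single_eq_same] at e2
  rcases Int.isUnit_iff.1 s.isUnit with hs | hs <;> omega

lemma isGreatest_rootString_zero (hα : α ∈ roots₀) (hγ : γ ∈ roots₁) (h : α + γ ∈ roots) :
    IsGreatest {r : ℕ | γ - (r : ℤ) • α ∈ roots ∪ {0}} 0 := by
  refine ⟨by simp [show γ ∈ roots from Or.inr hγ], fun r hr => ?_⟩
  have hodd : Odd ((γ - (r : ℤ) • α) 0) := by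
    exact (odd_apply_of_mem_roots₁ hγ 0).sub_even ((even_apply_of_mem_roots₀ hα 0).mul_left _)
  have hmem : γ - (r : ℤ) • α ∈ roots₁ :=
    mem_roots₁_of_odd_apply (hr.resolve_right fun h0 => by
      rw [Set.mem_singleton_iff.1 h0] at hodd
      simp at hodd) hodd
  have h1 := add_mem_roots₁ hα hγ h
  obtain ⟨i, s, rfl⟩ := mem_roots₀.1 hα
  have e1 := apply_eq_neg_of_single_add_mem_roots₁ hγ h1
  have e2 := mem_roots₁.1 hmem i
  simp only [Pi.sub_apply, Pi.smul_apply, Pi.single_eq_same, smul_eq_mul] at e2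
  rcases Int.isUnit_iff.1 s.isUnit with hs | hs <;> rw [hs] at e1 e2 <;> omega

lemma add_mem_oddRoots {s : ℤˣ} (hα : α ∈ evenRoots s) (hγ : γ ∈ oddRoots s)
    (h : α + γ ∈ roots₁) : α + γ ∈ oddRoots s := by
  refine ⟨?_, mem_roots₁.1 h⟩
  obtain ⟨i, rfl⟩ := hα
  have e1 := apply_eq_neg_of_single_add_mem_roots₁ (mem_roots₁.2 hγ.2) h
  have hγ0 := hγ.1
  by_cases hi : i = 0
  · subst hi
    rcases Int.isUnit_iff.1 s.isUnit with hs | hs <;> omega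
  · simp [Ne.symm hi, hγ.1]

end Roots

section Integrality
variable {K : Type*} [Field K] {a : K}

lemma adjoinZ_le_Za : adjoinZ a ≤ Za a := fun z hz =>
  Subring.subset_closure ⟨z, hz, 1, by simp [binom]⟩

lemma rootEval_apply (α : Fin 3 → ℤ) (c : Cartan K) : rootEval α c = ∑ i, (α i : K) * c i := by
  simp [rootEval]

lemma exists_algebraMap_eq_of_mem_span {R K V : Type*} [CommRing R] [CommRing K] [Algebra R K]
    [AddCommGroup V] [Module K V] [Module R V] [IsScalarTower R K V] (f : V →ₗ[K] K) {S : Set V}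
    (hS : ∀ x ∈ S, ∃ r : R, f x = algebraMap R K r) {x : V} (hx : x ∈ Submodule.span R S) :
    ∃ r : R, f x = algebraMap R K r := by
  have hle : Submodule.span R S ≤
      (LinearMap.range (Algebra.linearMap R K)).comap (f.restrictScalars R) :=
    Submodule.span_le.2 fun y hy => (hS y hy).imp fun _ h => h.symm
  exact (hle hx).imp fun _ h => h.symm

variable [CharZero K]

lemma coroot_single (i : Fin 3) : coroot a (Pi.single i 2) = Pi.single i 1 := by
  rw [coroot, if_neg (notMem_roots₁_of_mem_roots₀ (single_mem_roots₀ i))]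
  funext j
  by_cases h : j = i
  · subst h; simp
  · simp [h]

lemma exists_int_rootEval_coroot (α : Fin 3 → ℤ) {β : Fin 3 → ℤ} (hβ : β ∈ roots₀) :
    ∃ n : ℤ, rootEval α (coroot a β) = n := by
  obtain ⟨i, s, rfl⟩ := mem_roots₀.1 hβ
  refine ⟨α i * s, ?_⟩
  rw [rootEval_apply, coroot, if_neg (notMem_roots₁_of_mem_roots₀ hβ), Finset.sum_eq_single i]
  · simp
  · intro j _ hj
    simp [hj]
  · simp

lemma rootEval_coroot_mem_adjoinZ_of_odd {γ δ : Fin 3 → ℤ} (hγ : γ ∈ roots₁) (hδ : δ ∈ roots₁) :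
    rootEval γ (coroot a δ) ∈ adjoinZ a := by
  have hodd (i : Fin 3) : ∃ n : ℤ, (γ i : K) * δ i = 1 + 2 * n := by
    obtain ⟨n, hn⟩ := (odd_apply_of_mem_roots₁ hγ i).mul (odd_apply_of_mem_roots₁ hδ i)
    exact ⟨n, by exact_mod_cast hn.trans (add_comm _ _)⟩
  choose n hn using hodd
  have heval : rootEval γ (coroot a δ) = ((n 0 - n 1 : ℤ) : K) + ((n 0 - n 2 : ℤ) : K) * a := by
    rw [rootEval_apply, coroot, if_pos hδ, Fin.sum_univ_three]
    simp only [epsNorm, Matrix.cons_val_zero, Matrix.cons_val_one, Matrix.cons_val]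
    push_cast
    linear_combination ((1 + a) / 2) * hn 0 - (1 / 2) * hn 1 - (a / 2) * hn 2
  rw [heval]
  exact add_mem (intCast_mem _ _) (mul_mem (intCast_mem _ _) (Subring.subset_closure rfl))

lemma rootEval_coroot_mem_adjoinZ {γ β : Fin 3 → ℤ} (hγ : γ ∈ roots₁) (hβ : β ∈ roots) :
    rootEval γ (coroot a β) ∈ adjoinZ a := by
  rcases hβ with hβ | hβ
  · obtain ⟨n, hn⟩ := exists_int_rootEval_coroot (a := a) γ hβ
    exact hn ▸ intCast_mem _ n
  · exact rootEval_coroot_mem_adjoinZ_of_odd hγ hβ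

lemma rootForm_self_eq_zero {γ : Fin 3 → ℤ} (hγ : γ ∈ roots₁) : rootForm a γ γ = 0 := by
  have hsq (i : Fin 3) : (γ i : K) * γ i = 1 := by
    rcases mem_roots₁.1 hγ i with h | h <;> simp [h]
  simp only [rootForm, mul_assoc, hsq, Fin.sum_univ_three, epsNorm, Matrix.cons_val_zero,
    Matrix.cons_val_one, Matrix.cons_val]
  ring

end Integrality

section Brackets
variable {K : Type*} [Field K] {a : K}

lemma cartanIncl_mem_grading (c : Cartan K) :
    cartanIncl a c ∈ grading (K := K) (L := D21 K a) 0 := (mem_d21Grading_zero a).2 rfl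

variable (B : ChevalleyBasis a)

lemma bracket_cartan_X (c : Cartan K) {α : Fin 3 → ℤ} (hα : α ∈ roots) :
    bracket (K := K) (cartanIncl a c) (B.X α) = rootEval α c • B.X α := by
  have h : (bracket (K := K) (L := D21 K a)).flip (B.X α) ∘ₗ cartanIncl a =
      (rootEval α).smulRight (B.X α) :=
    B.H.ext fun i => by simpa using B.bracket_H_X i α hα
  simpa using LinearMap.congr_fun h c

lemma coroot_mem_cartanLattice {α : Fin 3 → ℤ} (hα : α ∈ roots) :
    coroot a α ∈ B.cartanLattice := by
  rw [ChevalleyBasis.cartanLattice, B.span_coroots]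
  exact Submodule.subset_span ⟨α, hα, rfl⟩

/-- The even root vectors and the coroots of the odd roots: the elements of `𝔤₀` of which the
brackets of odd root vectors are multiples. -/
def ChevalleyBasis.evenVectors : Set (D21 K a) :=
  B.X '' roots₀ ∪ (fun γ => cartanIncl a (coroot a γ)) '' roots₁

variable {B} in
lemma mem_grading_of_mem_evenVectors {x : D21 K a} (hx : x ∈ B.evenVectors) :
    x ∈ grading (K := K) (L := D21 K a) 0 := by
  rcases hx with ⟨α, hα, rfl⟩ | ⟨γ, -, rfl⟩
  exacts [B.X_even α hα, cartanIncl_mem_grading _]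

lemma bracket_X_self {γ : Fin 3 → ℤ} (hγ : γ ∈ roots₁) :
    bracket (K := K) (B.X γ) (B.X γ) = 0 := by
  obtain ⟨c, hc, hc0, -⟩ := B.bracket_X_X γ (Or.inr hγ) γ (Or.inr hγ) (add_self_ne_zero hγ)
  rw [hc, hc0 (add_self_notMem_roots hγ), zero_smul]

variable [CharZero K]

lemma bracket_even_odd {α γ : Fin 3 → ℤ} (hα : α ∈ roots₀) (hγ : γ ∈ roots₁) :
    ∃ δ : roots₁, (δ.1 = γ ∨ δ.1 = α + γ) ∧ bracket (K := K) (B.X α) (B.X δ) = 0 ∧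
      ∃ c : Za a, bracket (K := K) (B.X α) (B.X γ) = c • B.X δ := by
  obtain ⟨c, hc, hc0, hc1, hc2⟩ := B.bracket_X_X α (Or.inl hα) γ (Or.inr hγ)
    (add_ne_zero_of_mem_roots hα hγ)
  by_cases h : α + γ ∈ roots
  · have h1 := add_mem_roots₁ hα hγ h
    have hcZ : c ∈ Za a := by
      by_cases hiso : rootForm a α α = 0
      · obtain ⟨n, hn⟩ := exists_int_rootEval_coroot (a := a) γ hα
        rcases hc2 h hiso (rootForm_self_eq_zero hγ) with rfl | rfl <;> rw [hn]
        exacts [intCast_mem _ n, neg_mem (intCast_mem _ n)]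
      · rcases hc1 h (Or.inl hiso) 0 (isGreatest_rootString_zero hα hγ h) with rfl | rfl <;> simp
    obtain ⟨c', hc', hc'0, -⟩ := B.bracket_X_X α (Or.inl hα) (α + γ) (Or.inr h1)
      (add_ne_zero_of_mem_roots hα h1)
    exact ⟨⟨α + γ, h1⟩, Or.inr rfl,
      by rw [hc', hc'0 (add_add_notMem_roots hα hγ h), zero_smul], ⟨c, hcZ⟩, hc⟩
  · have h0 : bracket (K := K) (B.X α) (B.X γ) = 0 := by rw [hc, hc0 h, zero_smul]
    exact ⟨⟨γ, hγ⟩, Or.inl rfl, h0, 0, by rw [h0, zero_smul]⟩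

lemma bracket_odd_odd {γ δ : Fin 3 → ℤ} (hγ : γ ∈ roots₁) (hδ : δ ∈ roots₁) :
    ∃ x ∈ B.evenVectors, ∃ c : Za a, bracket (K := K) (B.X γ) (B.X δ) = c • x := by
  by_cases h0 : γ + δ = 0
  · obtain rfl : δ = -γ := (neg_eq_of_add_eq_zero_right h0).symm
    refine ⟨_, Or.inr ⟨γ, hγ, rfl⟩, ?_⟩
    by_cases hn : γ ∈ oddRoots (-1)
    · exact ⟨-1, by rw [B.bracket_X_neg_odd γ hn, neg_one_smul]⟩
    · exact ⟨1, by rw [B.bracket_X_neg γ (Or.inr hγ) hn, one_smul]⟩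
  · obtain ⟨c, hc, hc0, -, hc1⟩ := B.bracket_X_X γ (Or.inr hγ) δ (Or.inr hδ) h0
    by_cases h : γ + δ ∈ roots
    · refine ⟨_, Or.inl ⟨_, add_mem_roots₀ hγ hδ h, rfl⟩, ⟨c, ?_⟩, hc⟩
      have hm := adjoinZ_le_Za (rootEval_coroot_mem_adjoinZ_of_odd (a := a) hδ hγ)
      rcases hc1 h (rootForm_self_eq_zero hγ) (rootForm_self_eq_zero hδ) with rfl | rfl
      exacts [hm, neg_mem hm]
    · exact ⟨_, Or.inr ⟨γ, hγ, rfl⟩, 0, by rw [hc, hc0 h, zero_smul, zero_smul]⟩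

lemma bracket_evenVector_odd {x : D21 K a} (hx : x ∈ B.evenVectors) {γ : Fin 3 → ℤ}
    (hγ : γ ∈ roots₁) :
    ∃ δ ∈ roots₁, ∃ c : Za a, bracket (K := K) x (B.X γ) = c • B.X δ := by
  rcases hx with ⟨α, hα, rfl⟩ | ⟨δ, hδ, rfl⟩
  · obtain ⟨δ, -, -, hc⟩ := bracket_even_odd B hα hγ
    exact ⟨δ, δ.2, hc⟩
  · exact ⟨γ, hγ, ⟨_, adjoinZ_le_Za (rootEval_coroot_mem_adjoinZ_of_odd (a := a) hγ hδ)⟩,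
      bracket_cartan_X B _ (Or.inr hγ)⟩

end Brackets

section Action
variable {K : Type*} [Field K] {a : K} {B : ChevalleyBasis a}
  {V : Type*} [AddCommGroup V] [Module K V] {ρ : SuperRep K (D21 K a) V}
  {M : Submodule (Za a) V} (hM : IsAdmissible B ρ M)

lemma SuperRep.lift_ι (ρ : SuperRep K (D21 K a) V) (x : D21 K a) :
    ρ.lift (Enveloping.ι K _ x) = ρ.act x := by
  simp only [SuperRep.lift, Enveloping.ι]
  erw [RingQuot.liftAlgHom_mkAlgHom_apply]
  simp

lemma SuperRep.lift_binom (ρ : SuperRep K (D21 K a) V) (x : D21 K a) (n : ℕ) :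
    ρ.lift (binom K (Enveloping.ι K _ x) n) = binom K (ρ.act x) n := by
  rw [binom, map_smul, ← Polynomial.aeval_algHom_apply, ρ.lift_ι, binom]

/-- The endomorphism `f` of the lattice is given by the action of `x`. -/
def ActsAs (ρ : SuperRep K (D21 K a) V) {M : Submodule (Za a) V} (f : Module.End (Za a) M)
    (x : D21 K a) : Prop := ∀ m : M, (f m : V) = ρ.act x m

lemma ActsAs.ext {f g : Module.End (Za a) M} {x : D21 K a} (hf : ActsAs ρ f x)
    (hg : ActsAs ρ g x) : f = g :=
  LinearMap.ext fun m => Subtype.ext (by rw [hf m, hg m])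

lemma ActsAs.mul_eq {f g h : Module.End (Za a) M} {x y z : D21 K a} (hf : ActsAs ρ f x)
    (hg : ActsAs ρ g y) (hh : ActsAs ρ h z) {i j : ZMod 2}
    (hx : x ∈ grading (K := K) i) (hy : y ∈ grading (K := K) j) {c : Za a}
    (hc : bracket (K := K) x y = c • z) : f * g = koszul i j • (g * f) + c • h := by
  refine LinearMap.ext fun m => Subtype.ext ?_
  have e := LinearMap.congr_fun (ρ.act_bracket hx hy) (m : V)
  have e' : ρ.act (c • z) = (c : K) • ρ.act z := map_smul ρ.act (c : K) z
  rw [hc, e', LinearMap.sub_apply, eq_sub_iff_add_eq'] at e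
  simpa [hf _, hg _, hh _, Subring.smul_def] using e.symm

/-- The action of the odd root vector `X_γ` on the lattice. -/
abbrev IsAdmissible.oddAct (γ : roots₁) : Module.End (Za a) M :=
  hM.act ⟨_, odd_mem_kostant γ⟩

/-- The action of the divided power `X_α^(n)` on the lattice. -/
abbrev IsAdmissible.divPowAct (α : roots₀) (n : ℕ) : Module.End (Za a) M :=
  hM.act ⟨_, divPow_mem_kostant α n⟩

lemma IsAdmissible.act_apply (u : B.kostant) (m : M) : (hM.act u m : V) = ρ.lift u m := rfl

lemma IsAdmissible.actsAs_oddAct (γ : roots₁) : ActsAs ρ (hM.oddAct γ) (B.X γ) :=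
  fun m => by rw [hM.act_apply, ρ.lift_ι]

lemma IsAdmissible.divPowAct_apply (α : roots₀) (n : ℕ) (m : M) :
    (hM.divPowAct α n m : V) = ((n.factorial : K)⁻¹) • (ρ.act (B.X α) ^ n) m := by
  rw [hM.act_apply]
  simp only [divPow, map_smul, map_pow, ρ.lift_ι, LinearMap.smul_apply]

lemma IsAdmissible.divPowAct_zero (α : roots₀) : hM.divPowAct α 0 = 1 :=
  LinearMap.ext fun m => Subtype.ext <| by simp [hM.divPowAct_apply]

lemma IsAdmissible.actsAs_divPowAct_one (α : roots₀) : ActsAs ρ (hM.divPowAct α 1) (B.X α) :=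
  fun m => by simp [hM.divPowAct_apply]

lemma binom_mem_kostant {c : Cartan K} (hc : c ∈ B.cartanLattice) (n : ℕ) :
    binom K (Enveloping.ι K _ (cartanIncl a c)) n ∈ B.kostant :=
  Algebra.subset_adjoin (Or.inr ⟨c, hc, n, rfl⟩)

lemma IsAdmissible.exists_actsAs (hM : IsAdmissible B ρ M) {x : D21 K a} (hx : x ∈ B.evenVectors) :
    ∃ f : Module.End (Za a) M, ActsAs ρ f x := by
  rcases hx with ⟨α, hα, rfl⟩ | ⟨γ, hγ, rfl⟩
  · exact ⟨_, hM.actsAs_divPowAct_one ⟨α, hα⟩⟩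
  · exact ⟨hM.act ⟨_, binom_mem_kostant (coroot_mem_cartanLattice B (Or.inr hγ)) 1⟩,
      fun m => by rw [hM.act_apply, ρ.lift_binom]; simp [binom]⟩

variable (B ρ M) in
/-- The operators on the lattice given by the elements of `B.evenVectors`. -/
def evenOperators : Set (Module.End (Za a) M) := {f | ∃ x ∈ B.evenVectors, ActsAs ρ f x}

variable [CharZero K]

lemma IsAdmissible.oddAct_mul_self (γ : roots₁) : hM.oddAct γ * hM.oddAct γ = 0 := by
  have h := ρ.act_bracket (B.X_odd γ γ.2) (B.X_odd γ γ.2)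
  rw [bracket_X_self B γ.2, map_zero, koszul_one_one, neg_one_smul, sub_neg_eq_add, ← two_smul K,
    eq_comm, smul_eq_zero_iff_right two_ne_zero] at h
  refine LinearMap.ext fun m => Subtype.ext ?_
  rw [Module.End.mul_apply, hM.actsAs_oddAct, hM.actsAs_oddAct]
  exact LinearMap.congr_fun h m

theorem IsAdmissible.isOddSystem : IsOddSystem hM.oddAct (evenOperators B ρ M) where
  mul_self_eq_zero := hM.oddAct_mul_self
  exists_odd_odd γ δ := by
    obtain ⟨x, hx, c, hc⟩ := bracket_odd_odd B γ.2 δ.2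
    obtain ⟨f, hf⟩ := hM.exists_actsAs hx
    refine ⟨f, ⟨x, hx, hf⟩, c, ?_⟩
    rw [(hM.actsAs_oddAct γ).mul_eq (hM.actsAs_oddAct δ) hf (B.X_odd γ γ.2) (B.X_odd δ δ.2) hc,
      koszul_one_one, neg_one_zsmul]
  exists_even_odd := by
    rintro f ⟨x, hx, hf⟩ γ
    obtain ⟨δ, hδ, c, hc⟩ := bracket_evenVector_odd B hx γ.2
    refine ⟨⟨δ, hδ⟩, c, ?_⟩
    rw [hf.mul_eq (hM.actsAs_oddAct γ) (hM.actsAs_oddAct ⟨δ, hδ⟩)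
      (mem_grading_of_mem_evenVectors hx) (B.X_odd γ γ.2) hc, koszul_zero_left, one_smul]

lemma IsAdmissible.divPowAct_succ_mul_oddAct {α : roots₀} {γ δ : roots₁} {c : Za a}
    (hγ : bracket (K := K) (B.X α) (B.X γ) = c • B.X δ)
    (hδ : bracket (K := K) (B.X α) (B.X δ) = 0) (n : ℕ) :
    hM.divPowAct α (n + 1) * hM.oddAct γ =
      hM.oddAct γ * hM.divPowAct α (n + 1) + c • (hM.oddAct δ * hM.divPowAct α n) := by
  have e := ρ.act_bracket (B.X_even α α.2) (B.X_odd γ γ.2)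
  have e' : ρ.act (c • B.X δ) = (c : K) • ρ.act (B.X δ) := map_smul ρ.act (c : K) (B.X δ)
  rw [hγ, e', koszul_zero_left, one_smul, eq_sub_iff_add_eq'] at e
  have hcomm := ρ.act_bracket (B.X_even α α.2) (B.X_odd δ δ.2)
  rw [hδ, map_zero, koszul_zero_left, one_smul, eq_comm, sub_eq_zero] at hcomm
  have hpow := pow_succ_mul_of_commute e.symm (Commute.smul_right hcomm (c : K)) n
  have hn : (((n + 1).factorial : ℕ) : K)⁻¹ * (n + 1 : ℕ) = (n.factorial : K)⁻¹ := by
    rw [Nat.factorial_succ, Nat.cast_mul, mul_inv_rev, mul_assoc,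
      inv_mul_cancel₀ (by exact_mod_cast n.succ_ne_zero), mul_one]
  refine LinearMap.ext fun m => Subtype.ext ?_
  have h := LinearMap.congr_fun hpow (m : V)
  simp only [Module.End.mul_apply, LinearMap.add_apply, LinearMap.smul_apply, Submodule.coe_add,
    Submodule.coe_smul, hM.divPowAct_apply, hM.actsAs_oddAct γ _, hM.actsAs_oddAct δ _,
    map_smul] at h ⊢
  rw [h, smul_add, ← Nat.cast_smul_eq_nsmul K, smul_smul, hn, Subring.smul_def, smul_comm (c : K)]

end Action

section Eigenvectors
variable {K : Type*} [Field K] {V : Type*} [AddCommGroup V] [Module K V]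

variable (K) in
/-- The ring of endomorphisms of `V` preserving the additive subgroup `L`. -/
def stabilizerSubring (L : AddSubgroup V) : Subring (Module.End K V) where
  carrier := {T | ∀ v ∈ L, T v ∈ L}
  mul_mem' hS hT v hv := hS _ (hT v hv)
  one_mem' _ hv := hv
  add_mem' hS hT v hv := add_mem (hS v hv) (hT v hv)
  zero_mem' _ _ := zero_mem L
  neg_mem' hT v hv := neg_mem (hT v hv)

variable [CharZero K]

lemma binom_apply_of_eigenvector {f : Module.End K V} {z : K} {v : V} (h : f v = z • v) (n : ℕ) :
    binom K f n v = Ring.choose z n • v := by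
  rw [← binom_eq_choose, binom, LinearMap.smul_apply,
    Module.End.aeval_apply_of_mem_apply_eq_smul h, binom, smul_smul, smul_eq_mul,
    Polynomial.coe_aeval_eq_eval]

variable {S : Subring (Module.End K V)}

lemma exists_shifted_binom {f : Module.End K V} (hf : ∀ n, binom K f n ∈ S) (c : ℤ) (n : ℕ) :
    ∃ T ∈ S, ∀ (x : K) (v : V), f v = x • v → T v = Ring.choose (x + c) n • v := by
  refine ⟨∑ p ∈ Finset.HasAntidiagonal.antidiagonal n, Ring.choose c p.2 • binom K f p.1,
    sum_mem fun p _ => zsmul_mem (hf p.1) _, fun x v hv => ?_⟩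
  rw [LinearMap.sum_apply, Ring.add_choose_eq n (Commute.all x (c : K)), Finset.sum_smul]
  refine Finset.sum_congr rfl fun p _ => ?_
  have hcast : Ring.choose (c : K) p.2 = ((Ring.choose c p.2 : ℤ) : K) :=
    (Ring.map_choose (Int.castRingHom K) c p.2).symm
  rw [LinearMap.smul_apply, binom_apply_of_eigenvector hv, hcast, mul_comm, mul_smul,
    Int.cast_smul_eq_zsmul]

lemma exists_separating_operator {f : Module.End K V} (hf : ∀ n, binom K f n ∈ S) {z w : ℤ}
    (hzw : z ≠ w) : ∃ T ∈ S, ∃ φ : K → K, φ z = 1 ∧ φ w = 0 ∧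
      ∀ (x : K) (v : V), f v = x • v → T v = φ x • v := by
  rcases hzw.lt_or_gt with h | h
  · obtain ⟨n, rfl⟩ : ∃ n : ℕ, w = z + n + 1 := ⟨(w - z - 1).toNat, by omega⟩
    obtain ⟨T, hT, hTv⟩ := exists_shifted_binom hf (-(z + 1)) (n + 1)
    refine ⟨Int.negOnePow (n + 1 : ℕ) • T, zsmul_mem hT _,
      fun x => Int.negOnePow (n + 1 : ℕ) • Ring.choose (x + (-(z + 1) : ℤ)) (n + 1),
      ?_, ?_, fun x v hv => by rw [LinearMap.smul_apply, hTv x v hv, smul_assoc]⟩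
    · have e : (z : K) + (-(z + 1) : ℤ) = -1 := by push_cast; ring
      have h1 : (1 : K) + (n + 1 : ℕ) - 1 = (n + 1 : ℕ) := by ring
      beta_reduce
      rw [e, Ring.choose_neg, h1, Ring.choose_natCast, Nat.choose_self, smul_smul,
        ← Int.negOnePow_add, Int.negOnePow_even _ (Even.add_self _), one_smul, Nat.cast_one]
    · have e : ((z + n + 1 : ℤ) : K) + (-(z + 1) : ℤ) = (n : ℕ) := by push_cast; ring
      beta_reduce
      rw [e, Ring.choose_natCast, Nat.choose_succ_self, Nat.cast_zero, smul_zero]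
  · obtain ⟨n, rfl⟩ : ∃ n : ℕ, z = w + n + 1 := ⟨(z - w - 1).toNat, by omega⟩
    obtain ⟨T, hT, hTv⟩ := exists_shifted_binom hf (-w) (n + 1)
    refine ⟨T, hT, fun x => Ring.choose (x + (-w : ℤ)) (n + 1), ?_, ?_, hTv⟩
    · have e : ((w + n + 1 : ℤ) : K) + (-w : ℤ) = (n + 1 : ℕ) := by push_cast; ring
      beta_reduce
      rw [e, Ring.choose_natCast, Nat.choose_self, Nat.cast_one]
    · have e : (w : K) + (-w : ℤ) = (0 : ℕ) := by push_cast; ring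
      beta_reduce
      rw [e, Ring.choose_natCast, Nat.choose_zero_succ, Nat.cast_zero]

variable {ι κ : Type*} {f : ι → Module.End K V} {v : κ → V} {z : κ → ι → ℤ}

lemma exists_projection (hf : ∀ i n, binom K (f i) n ∈ S) (s : Finset κ)
    (hv : ∀ j i, f i (v j) = (z j i : K) • v j) {j₀ : κ} (hz : ∀ j ∈ s, z j₀ ≠ z j) :
    ∃ T ∈ S, T (v j₀) = v j₀ ∧ ∀ j ∈ s, T (v j) = 0 := by
  classical
  induction s using Finset.induction_on with
  | empty => exact ⟨1, one_mem S, rfl, by simp⟩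
  | insert j₁ s _ ih =>
    obtain ⟨T, hT, h₀, hs⟩ := ih fun j hj => hz j (Finset.mem_insert_of_mem hj)
    obtain ⟨i, hi⟩ := Function.ne_iff.1 (hz j₁ (Finset.mem_insert_self j₁ s))
    obtain ⟨P, hP, φ, hφ₀, hφ₁, hPv⟩ := exists_separating_operator (hf i) hi
    refine ⟨T * P, mul_mem hT hP, ?_, Finset.forall_mem_insert _ _ _ |>.2 ⟨?_, fun j hj => ?_⟩⟩
    · rw [Module.End.mul_apply, hPv _ _ (hv j₀ i), hφ₀, one_smul, h₀]
    · rw [Module.End.mul_apply, hPv _ _ (hv j₁ i), hφ₁, zero_smul, map_zero]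
    · rw [Module.End.mul_apply, hPv _ _ (hv j i), map_smul, hs j hj, smul_zero]

lemma mem_of_sum_mem {L : AddSubgroup V} (hf : ∀ i n, binom K (f i) n ∈ stabilizerSubring K L)
    (hv : ∀ j i, f i (v j) = (z j i : K) • v j) {s : Finset κ} (hz : Set.InjOn z s)
    (hL : ∑ j ∈ s, v j ∈ L) {j : κ} (hj : j ∈ s) : v j ∈ L := by
  classical
  obtain ⟨T, hT, hTj, hTs⟩ := exists_projection hf (s.erase j) hv fun i hi h =>
    Finset.ne_of_mem_erase hi (hz (Finset.mem_of_mem_erase hi) hj h.symm)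
  have h := hT _ hL
  rwa [map_sum, ← Finset.add_sum_erase s _ hj, hTj, Finset.sum_eq_zero hTs, add_zero] at h

end Eigenvectors

section Weights
variable {K : Type*} [Field K] {a : K} {B : ChevalleyBasis a}
  {V : Type*} [AddCommGroup V] [Module K V] {ρ : SuperRep K (D21 K a) V}
  {M : Submodule (Za a) V}

lemma IsAdmissible.binom_mem_stabilizerSubring (hM : IsAdmissible B ρ M) {c : Cartan K}
    (hc : c ∈ B.cartanLattice) (n : ℕ) :
    binom K (ρ.act (cartanIncl a c)) n ∈ stabilizerSubring K M.toAddSubgroup := fun m hm => by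
  rw [← ρ.lift_binom]
  exact hM.stable _ (binom_mem_kostant hc n) m hm

variable [CharZero K]

lemma IsAdmissible.mem_of_sum_mem_weightSpace (hρ : IsRational B ρ) (hM : IsAdmissible B ρ M)
    {v : (Cartan K →ₗ[K] K) →₀ V} (hv : ∀ μ, v μ ∈ weightSpace ρ μ)
    (h : (v.sum fun _ x => x) ∈ M) (μ : Cartan K →ₗ[K] K) : v μ ∈ M := by
  by_cases hμ : v μ = 0
  · rw [hμ]; exact zero_mem M
  have hint (μ : Cartan K →ₗ[K] K) (i : Fin 3) :
      ∃ n : ℤ, v μ ≠ 0 → μ (Pi.single i 1) = n := by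
    by_cases hμ : v μ = 0
    · exact ⟨0, fun h => (h hμ).elim⟩
    · obtain ⟨n, hn⟩ := hρ.weight_coroot μ
        ((Submodule.ne_bot_iff _).2 ⟨_, hv μ, hμ⟩) _ (single_mem_roots₀ i)
      exact ⟨n, fun _ => by rw [← hn, coroot_single]⟩
  choose z hz using hint
  refine mem_of_sum_mem (L := M.toAddSubgroup) (z := z)
    (f := fun i => ρ.act (cartanIncl a (Pi.single i 1))) (fun i n => ?_) (fun μ i => ?_)
    (s := v.support) (fun μ hμ ν hν hμν => ?_) h (Finsupp.mem_support_iff.2 hμ)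
  · refine hM.binom_mem_stabilizerSubring ?_ n
    rw [← coroot_single (a := a)]
    exact coroot_mem_cartanLattice B (Or.inl (single_mem_roots₀ i))
  · by_cases hμ : v μ = 0
    · simp [hμ]
    · rw [← hz μ i hμ, hv μ]
  · refine (Pi.basisFun K (Fin 3)).ext fun i => ?_
    rw [Pi.basisFun_apply, hz μ i (Finsupp.mem_support_iff.1 hμ),
      hz ν i (Finsupp.mem_support_iff.1 hν), hμν]

theorem IsAdmissible.closure_weightVectors (hρ : IsRational B ρ) (hM : IsAdmissible B ρ M) :
    AddSubgroup.closure {m : M | ∃ μ, (m : V) ∈ weightSpace ρ μ} = ⊤ := by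
  refine eq_top_iff.2 fun m _ => ?_
  obtain ⟨v, hv, hvm⟩ := (Submodule.mem_iSup_iff_exists_finsupp _ _).1
    (hρ.iSup_weightSpace ▸ Submodule.mem_top : (m : V) ∈ ⨆ μ, weightSpace ρ μ)
  have hvM := hM.mem_of_sum_mem_weightSpace hρ hv (hvm ▸ m.2)
  have hm : m = ∑ μ ∈ v.support, ⟨v μ, hvM μ⟩ := Subtype.ext (by
    rw [← hvm, AddSubmonoidClass.coe_finsetSum, Finsupp.sum])
  rw [hm]
  exact sum_mem fun μ _ => AddSubgroup.subset_closure ⟨μ, hv μ⟩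

end Weights

section Tangent
variable {R : Type*} [CommRing R] (k : Type*) [CommRing k] [Algebra R k]

/-- The reduction `f ↦ f mod X²` of power series, with coefficients extended to `k`. -/
def truncateToDualNumber : PowerSeries R →ₐ[R] DualNumber k where
  toFun f := .inl (algebraMap R k (PowerSeries.coeff 0 f)) +
    .inr (algebraMap R k (PowerSeries.coeff 1 f))
  map_one' := TrivSqZeroExt.ext (by simp) (by simp [PowerSeries.coeff_one])
  map_zero' := TrivSqZeroExt.ext (by simp) (by simp)
  map_add' f g := TrivSqZeroExt.ext (by simp) (by simp [Algebra.smul_def])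
  map_mul' f g := TrivSqZeroExt.ext (by simp) (by
    simp [PowerSeries.coeff_mul, Finset.Nat.antidiagonal_succ, Algebra.smul_def, mul_comm,
      TrivSqZeroExt.algebraMap_eq_inl'])
  commutes' r := TrivSqZeroExt.ext (by simp [TrivSqZeroExt.algebraMap_eq_inl'])
    (by simp [PowerSeries.coeff_C, TrivSqZeroExt.algebraMap_eq_inl'])

variable {K : Type*} [Field K] {a : K} {k} [Algebra (Za a) k] {A : Type*} [Ring A] [Algebra k A]
  {𝒜 : ZMod 2 → Submodule k A} [GradedAlgebra 𝒜]

/-- The point `ℓ ↦ 1 + d` of `P_a(A)`, for an even element `d` of square zero. -/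
def tangentPoint (d : A) (hd : d ∈ 𝒜 0) (hdd : d * d = 0) : PaPoint a 𝒜 where
  hom := (DualNumber.lift ⟨(Algebra.ofId k A, d), hdd, fun c => (Algebra.commutes c d).symm⟩).comp
    (Algebra.TensorProduct.lift (Algebra.ofId k (DualNumber k))
      ((truncateToDualNumber k).comp (ellAlgebra a).val) fun _ _ => Commute.all _ _)
  hom_mem r := by
    rw [AlgHom.comp_apply, DualNumber.lift_apply_apply]
    simp only [Algebra.ofId_apply]
    rw [← Algebra.smul_def]
    exact add_mem (SetLike.algebraMap_mem_graded 𝒜 _) ((𝒜 0).smul_mem _ hd)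

lemma tangentPoint_pow [CharZero K] {d : A} (hd : d ∈ 𝒜 0) (hdd : d * d = 0) (z : adjoinZ a) :
    (tangentPoint d hd hdd).pow z =
      1 + algebraMap (Za a) k ⟨z, adjoinZ_le_Za z.2⟩ • d := by
  have h0 : PowerSeries.coeff 0 (ellPow a z) = 1 := Subtype.ext (by simp [ellPow, binom])
  have h1 : PowerSeries.coeff 1 (ellPow a z) = ⟨(z : K), adjoinZ_le_Za z.2⟩ :=
    Subtype.ext (by simp [ellPow, binom])
  have htrunc : truncateToDualNumber k (ellPow a z) =
      .inl 1 + .inr (algebraMap (Za a) k ⟨z, adjoinZ_le_Za z.2⟩) := by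
    rw [← h1, ← map_one (algebraMap (Za a) k), ← h0]
    rfl
  rw [PaPoint.pow, tangentPoint, AlgHom.comp_apply, Algebra.TensorProduct.lift_tmul, map_one,
    one_mul, AlgHom.comp_apply, Subalgebra.coe_val, htrunc, DualNumber.lift_apply_apply,
    Algebra.smul_def]
  simp [Algebra.ofId_apply, Algebra.smul_def _ (1 : k)]

end Tangent

section Toral
variable {K : Type*} [Field K] {a : K} {B : ChevalleyBasis a}
  {V : Type*} [AddCommGroup V] [Module K V] {ρ : SuperRep K (D21 K a) V}
  {M : Submodule (Za a) V} (hM : IsAdmissible B ρ M)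
  {k : Type*} [CommRing k] [Algebra (Za a) k] {A : Type*} [Ring A] [Algebra k A]
  {𝒜 : ZMod 2 → Submodule k A}

lemma act_mem_weightSpace {γ : Fin 3 → ℤ} (hγ : γ ∈ roots₁) {μ : Cartan K →ₗ[K] K} {v : V}
    (hv : v ∈ weightSpace ρ μ) : ρ.act (B.X γ) v ∈ weightSpace ρ (μ + rootEval γ) := by
  intro c
  have e := ρ.act_bracket (cartanIncl_mem_grading (a := a) c) (B.X_odd γ hγ)
  rw [bracket_cartan_X B c (Or.inr hγ), koszul_zero_left, one_smul, map_smul] at e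
  have e' := LinearMap.congr_fun e v
  simp only [LinearMap.smul_apply, LinearMap.sub_apply, Module.End.mul_apply] at e'
  rw [hv c, map_smul, eq_sub_iff_add_eq] at e'
  rw [← e', LinearMap.add_apply, add_smul, add_comm]

variable {R : Type*} [CommRing R] [Algebra R K] {c : Cartan K} {p : Multiplicative R →* A}

/-- `g` acts on the vectors of weight `μ` as `p (μ c)` whenever `μ c ∈ R`: the common description
of the operators `h_H(t)`, where `R = ℤ` and `p n = t ^ n`, and `h_H^{[a]}(φ)`, where `R = ℤ[a]` and
`p z = φ (ℓ ^ z)`. -/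
def IsAdmissible.ActsByCharacter (c : Cartan K) (p : Multiplicative R →* A)
    (g : Module.End A (hM.Points k A)) : Prop :=
  ∀ (μ : Cartan K →ₗ[K] K) (z : R), μ c = algebraMap R K z → ∀ m : M, (m : V) ∈ weightSpace ρ μ →
    g (1 ⊗ₜ (1 ⊗ₜ m)) = p (.ofAdd z) ⊗ₜ (1 ⊗ₜ m)

variable [CharZero K]

lemma IsAdmissible.ActsByCharacter.mul_xOdd {g : Module.End A (hM.Points k A)}
    (hg : hM.ActsByCharacter c p g) (hρ : IsRational B ρ)
    (hint : ∀ μ, weightSpace ρ μ ≠ ⊥ → ∃ z : R, μ c = algebraMap R K z) {γ : roots₁} {j : R}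
    (hj : rootEval γ.1 c = algebraMap R K j) {ϑ : A} (hϑ : ∀ z, Commute (p z) ϑ) :
    g * hM.xOdd k γ ϑ = hM.xOdd k γ (ϑ * p (.ofAdd j)) * g := by
  refine tensorEnd_ext_of_closure_eq_top (hM.closure_weightVectors hρ) ?_
  rintro m ⟨μ, hm⟩
  by_cases hm0 : m = 0
  · simp [hm0]
  obtain ⟨z, hz⟩ := hint μ ((Submodule.ne_bot_iff _).2 ⟨m, hm, by simpa using hm0⟩)
  have hz' : (μ + rootEval γ.1 : Cartan K →ₗ[K] K) c = algebraMap R K (z + j) := by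
    rw [LinearMap.add_apply, hz, hj, map_add]
  have hXm : (hM.oddAct γ m : V) ∈ weightSpace ρ (μ + rootEval γ.1) := by
    rw [hM.actsAs_oddAct γ m]
    exact act_mem_weightSpace γ.2 hm
  have hgϑ : g (ϑ ⊗ₜ (1 ⊗ₜ hM.oddAct γ m)) =
      (ϑ * p (.ofAdd (z + j))) ⊗ₜ (1 ⊗ₜ hM.oddAct γ m) := by
    rw [← smul_eq_mul, ← smul_tmul', ← hg _ _ hz' _ hXm, ← map_smul, smul_tmul', smul_eq_mul,
      mul_one]
  have hxOdd (b η : A) : hM.xOdd k γ η (b ⊗ₜ (1 ⊗ₜ m)) =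
      b ⊗ₜ (1 ⊗ₜ m) + (b * η) ⊗ₜ (1 ⊗ₜ hM.oddAct γ m) :=
    congrArg (b ⊗ₜ (1 ⊗ₜ m) + ·) (tensorOp_tmul η b (hM.oddAct γ) m)
  rw [Module.End.mul_apply, Module.End.mul_apply, hxOdd, hg μ z hz m hm, hxOdd, map_add,
    hg μ z hz m hm, one_mul, hgϑ, ofAdd_add, map_mul, ← mul_assoc, ← mul_assoc, (hϑ _).eq]

variable [GradedAlgebra 𝒜]

theorem IsAdmissible.ActsByCharacter.mem_normalizer {g : hM.GL k A}
    (hg : hM.ActsByCharacter c p (g : Module.End A (hM.Points k A))) (h𝒜 : IsSupercommutative 𝒜)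
    (hp : ∀ z, p z ∈ 𝒜 0) (hρ : IsRational B ρ)
    (hint : ∀ μ, weightSpace ρ μ ≠ ⊥ → ∃ z : R, μ c = algebraMap R K z)
    (hroot : ∀ γ : roots₁, ∃ j : R, rootEval γ.1 c = algebraMap R K j) :
    g ∈ Subgroup.normalizer
      (Subgroup.closure (⋃ γ, hM.oddOneParam 𝒜 γ) : Set (hM.GL k A)) := by
  have hcomm (ϑ : A) (z : Multiplicative R) : Commute (p z) ϑ := commute_of_mem_even h𝒜 (hp z) ϑ
  refine mem_normalizer_closure (fun s hs => ?_) (fun s hs => ?_) <;>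
    obtain ⟨γ, ϑ, hϑ, hs⟩ := Set.mem_iUnion.1 hs <;> obtain ⟨j, hj⟩ := hroot γ <;>
    refine Subgroup.subset_closure (Set.mem_iUnion.2 ⟨γ, ?_⟩)
  · refine ⟨ϑ * p (.ofAdd j), mul_mem_odd hϑ (hp _), ?_⟩
    rw [Units.val_mul, Units.mul_inv_eq_iff_eq_mul, Units.val_mul, hs]
    exact hg.mul_xOdd hM hρ hint hj (hcomm ϑ)
  · refine ⟨ϑ * p (.ofAdd (-j)), mul_mem_odd hϑ (hp _), ?_⟩
    have h := hg.mul_xOdd hM hρ hint hj (hcomm (ϑ * p (.ofAdd (-j))))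
    rw [mul_assoc, ← map_mul, ← ofAdd_add, neg_add_cancel, ofAdd_zero, map_one, mul_one] at h
    rw [mul_assoc, Units.val_mul, Units.inv_mul_eq_iff_eq_mul, Units.val_mul, hs, h]

lemma zpow_mem_even {t : Aˣ} (ht : (t : A) ∈ 𝒜 0) (ht' : ((t⁻¹ : Aˣ) : A) ∈ 𝒜 0) (n : ℤ) :
    ((t ^ n : Aˣ) : A) ∈ 𝒜 0 := by
  have hpow {s : A} (hs : s ∈ 𝒜 0) (m : ℕ) : s ^ m ∈ 𝒜 0 := by
    simpa using SetLike.pow_mem_graded m hs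
  obtain ⟨m, rfl | rfl⟩ := n.eq_nat_or_neg
  · simpa using hpow ht m
  · rw [zpow_neg, zpow_natCast, ← inv_pow, Units.val_pow_eq_pow_val]
    exact hpow ht' m

lemma IsAdmissible.torusOneParam_subset_normalizer (h𝒜 : IsSupercommutative 𝒜)
    (hρ : IsRational B ρ) (c : cartanZ a) :
    hM.torusOneParam 𝒜 c ⊆ (Subgroup.normalizer
      (Subgroup.closure (⋃ γ, hM.oddOneParam 𝒜 γ) : Set (hM.GL k A)) : Set (hM.GL k A)) := by
  rintro g ⟨t, ht, ht', hg⟩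
  have hchar : hM.ActsByCharacter c.1 ((Units.coeHom A).comp (zpowersHom Aˣ t))
      (g : Module.End A (hM.Points k A)) := fun μ n hn m hm => hg μ n (by simpa using hn) m hm
  refine hchar.mem_normalizer hM h𝒜 (fun n => zpow_mem_even ht ht' n.toAdd) hρ
    (fun μ hμ => exists_algebraMap_eq_of_mem_span μ ?_ c.2)
    fun γ => exists_algebraMap_eq_of_mem_span (rootEval γ.1) ?_ c.2 <;> rintro _ ⟨α, hα, rfl⟩
  · simpa using hρ.weight_coroot μ hμ α hα
  · simpa using exists_int_rootEval_coroot (a := a) γ.1 hα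

/-- The character `z ↦ φ (ℓ ^ z)` of `ℤ[a]` defined by a point `φ` of `P_a(A)`. -/
def PaPoint.powHom {𝒜 : ZMod 2 → Submodule k A} (t : PaPoint a 𝒜) :
    Multiplicative (adjoinZ a) →* A where
  toFun z := t.pow z.toAdd
  map_one' := by
    rw [toAdd_one, PaPoint.pow, ← map_one t.hom, Algebra.TensorProduct.one_def]
    congr 3
    exact ellPow_zero
  map_mul' z w := by
    rw [toAdd_mul, PaPoint.pow, PaPoint.pow, PaPoint.pow, ← map_mul,
      Algebra.TensorProduct.tmul_mul_tmul, one_mul]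
    congr 3
    exact ellPow_add z.toAdd w.toAdd

lemma IsAdmissible.aTorusOneParam_subset_normalizer (h𝒜 : IsSupercommutative 𝒜)
    (hρ : IsRational B ρ) (c : B.cartanLattice) :
    hM.aTorusOneParam 𝒜 c ⊆ (Subgroup.normalizer
      (Subgroup.closure (⋃ γ, hM.oddOneParam 𝒜 γ) : Set (hM.GL k A)) : Set (hM.GL k A)) := by
  rintro g ⟨t, hg⟩
  have hchar : hM.ActsByCharacter c.1 t.powHom (g : Module.End A (hM.Points k A)) := hg
  have hc : c.1 ∈ Submodule.span (adjoinZ a) (coroot a '' roots) := B.span_coroots ▸ c.2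
  refine hchar.mem_normalizer hM h𝒜 (fun z => t.hom_mem _) hρ
    (fun μ hμ => exists_algebraMap_eq_of_mem_span μ ?_ c.2)
    fun γ => exists_algebraMap_eq_of_mem_span (rootEval γ.1) ?_ hc
  · rintro _ ⟨i, rfl⟩
    exact ⟨⟨_, hρ.weight_H μ hμ i⟩, rfl⟩
  · rintro _ ⟨α, hα, rfl⟩
    exact ⟨⟨_, rootEval_coroot_mem_adjoinZ γ.2 hα⟩, rfl⟩

end Toral

section EvenRoots
variable {K : Type*} [Field K] {a : K} {B : ChevalleyBasis a}
  {V : Type*} [AddCommGroup V] [Module K V] {ρ : SuperRep K (D21 K a) V}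
  {M : Submodule (Za a) V} (hM : IsAdmissible B ρ M)
  {k : Type*} [CommRing k] [Algebra (Za a) k] {A : Type*} [Ring A] [Algebra k A]
  {𝒜 : ZMod 2 → Submodule k A}

lemma IsAdmissible.xOdd_zero (γ : roots₁) : hM.xOdd k γ (0 : A) = 1 := by
  change 1 + tensorOp k (0 : A) (hM.oddAct γ) = 1
  rw [map_zero, AddMonoidHom.zero_apply, add_zero]

variable [CharZero K]

lemma IsAdmissible.exists_val_eq_xOdd (γ : roots₁) (ϑ : A) :
    ∃ g : hM.GL k A, (g : Module.End A (hM.Points k A)) = hM.xOdd k γ ϑ :=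
  ⟨oneAddUnit (R := Module.End A (hM.Points k A)) (tensorOp k ϑ (hM.oddAct γ))
    (by rw [tensorOp_mul, hM.oddAct_mul_self, map_zero]), rfl⟩

lemma IsAdmissible.xEven_mul_xOdd {α : roots₀} {γ δ : roots₁} {c : Za a}
    (hγ : bracket (K := K) (B.X α) (B.X γ) = c • B.X δ)
    (hδ : bracket (K := K) (B.X α) (B.X δ) = 0) {t ϑ : A} (ht : Commute t ϑ) (hϑ : ϑ * ϑ = 0) :
    hM.xEven k α t * hM.xOdd k γ ϑ =
      hM.xOdd k γ ϑ * hM.xOdd k δ (algebraMap (Za a) k c • (ϑ * t)) * hM.xEven k α t :=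
  finsum_tensorOp_mul (hM.divPowAct_zero α) (hM.divPowAct_succ_mul_oddAct hγ hδ) ht hϑ

lemma IsAdmissible.commute_xEven_xOdd {α : roots₀} {δ : roots₁}
    (hδ : bracket (K := K) (B.X α) (B.X δ) = 0) {t ϑ : A} (ht : Commute t ϑ) (hϑ : ϑ * ϑ = 0) :
    Commute (hM.xEven k α t) (hM.xOdd k δ ϑ) := by
  have h := hM.xEven_mul_xOdd (k := k) (δ := δ) (c := 0) (by rw [hδ, zero_smul]) hδ ht hϑ
  rwa [map_zero, zero_smul, hM.xOdd_zero, mul_one] at h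

theorem IsAdmissible.evenOneParam_subset_normalizer [GradedAlgebra 𝒜] (h𝒜 : IsSupercommutative 𝒜)
    (hsq : ∀ x ∈ 𝒜 1, x * x = 0) {α : roots₀} {P : Set (Fin 3 → ℤ)}
    (hP : ∀ γ ∈ roots₁, γ ∈ P → α.1 + γ ∈ roots₁ → α.1 + γ ∈ P) :
    hM.evenOneParam 𝒜 α ⊆ (Subgroup.normalizer (Subgroup.closure
      (⋃ γ, ⋃ (_ : γ.1 ∈ P), hM.oddOneParam 𝒜 γ) : Set (hM.GL k A)) : Set (hM.GL k A)) := by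
  rintro g ⟨t, ht, hg⟩
  refine mem_normalizer_closure_of_commute fun s hs => ?_
  obtain ⟨γ, hγ, ϑ, hϑ, hs⟩ := Set.mem_iUnion₂.1 hs
  obtain ⟨δ, hδγ, hαδ, c, hc⟩ := bracket_even_odd B α.2 γ.2
  have hδP : δ.1 ∈ P := by
    rcases hδγ with h | h
    · exact h ▸ hγ
    · exact h ▸ hP γ γ.2 hγ (h ▸ δ.2)
  have hη : algebraMap (Za a) k c • (ϑ * t) ∈ 𝒜 1 := (𝒜 1).smul_mem _ (mul_mem_odd hϑ ht)
  obtain ⟨y, hy⟩ := hM.exists_val_eq_xOdd (k := k) δ (algebraMap (Za a) k c • (ϑ * t))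
  have hgy := hM.commute_xEven_xOdd (k := k) hαδ (commute_of_mem_even h𝒜 ht _) (hsq _ hη)
  have hgs := hM.xEven_mul_xOdd (k := k) hc hαδ (commute_of_mem_even h𝒜 ht ϑ) (hsq ϑ hϑ)
  rw [← hg, ← hy] at hgy hgs
  rw [← hs] at hgs
  exact ⟨y, Subgroup.subset_closure (Set.mem_iUnion₂.2 ⟨δ, hδP, _, hη, hy⟩),
    Units.ext hgy, Units.ext hgs⟩

end EvenRoots

section Factorization
variable {K : Type*} [Field K] [CharZero K] {a : K} {B : ChevalleyBasis a}
  {V : Type*} [AddCommGroup V] [Module K V] {ρ : SuperRep K (D21 K a) V}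
  {M : Submodule (Za a) V} (hM : IsAdmissible B ρ M)
  {k : Type*} [CommRing k] [Algebra (Za a) k] {A : Type*} [Ring A] [Algebra k A]
  {𝒜 : ZMod 2 → Submodule k A}

lemma IsAdmissible.coe_oneParamSubgroup_oddAct (γ : roots₁) :
    (oneParamSubgroup k (hM.oddAct_mul_self γ) (𝒜 1) : Set (hM.GL k A)) = hM.oddOneParam 𝒜 γ :=
  rfl

lemma IsAdmissible.inv_iUnion_oddOneParam_subset (P : Set (Fin 3 → ℤ)) :
    (⋃ γ, ⋃ (_ : γ.1 ∈ P), hM.oddOneParam 𝒜 γ : Set (hM.GL k A))⁻¹ ⊆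
      ⋃ γ, ⋃ (_ : γ.1 ∈ P), hM.oddOneParam 𝒜 γ := by
  simp only [← hM.coe_oneParamSubgroup_oddAct, Set.iUnion_inv, inv_coe_set, subset_refl]

lemma IsAdmissible.closure_iUnion_oddOneParam :
    Subgroup.closure (⋃ γ, hM.oddOneParam 𝒜 γ : Set (hM.GL k A)) =
      hM.isOddSystem.oddClosure 𝒜 ⊤ := by
  simp only [IsOddSystem.oddClosure, inf_top_eq, ← hM.coe_oneParamSubgroup_oddAct]

lemma IsAdmissible.G₁_eq_closure :
    hM.G₁ 𝒜 = (Subgroup.closure (⋃ γ, hM.oddOneParam 𝒜 γ) : Set (hM.GL k A)) :=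
  coe_submonoidClosure_eq_subgroupClosure (by
    simpa using hM.inv_iUnion_oddOneParam_subset (𝒜 := 𝒜) Set.univ)

lemma IsAdmissible.G₁ord_eq_orderedProd (e : Fin 8 ≃ roots₁) :
    hM.G₁ord 𝒜 e = (orderedProd (fun γ => oneParamSubgroup k (hM.oddAct_mul_self γ) (𝒜 1))
      (List.ofFn e) : Set (hM.GL k A)) := by
  have hval (f : Fin 8 → hM.GL k A) : ((List.ofFn f).prod : Module.End A (hM.Points k A)) =
      (List.ofFn fun i => (f i : Module.End A (hM.Points k A))).prod := by
    rw [← Units.coeHom_apply, map_list_prod, List.map_ofFn]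
    rfl
  ext g
  rw [orderedProd, List.map_ofFn, Set.mem_prod_list_ofFn]
  constructor
  · rintro ⟨ϑ, hϑ, hg⟩
    choose f hf using fun i => hM.exists_val_eq_xOdd (k := k) (e i) (ϑ i)
    refine ⟨fun i => ⟨f i, ϑ i, hϑ i, hf i⟩, Units.ext ?_⟩
    simp only [hval, hf, hg]
  · rintro ⟨f, rfl⟩
    choose ϑ hϑ hf using fun i => (f i).2
    refine ⟨ϑ, hϑ, ?_⟩
    simp only [hval, hf]
    rfl

lemma IsAdmissible.evenOneParam_subset_G₀ (α : roots₀) :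
    hM.evenOneParam 𝒜 α ⊆ (hM.G₀ 𝒜 : Set (hM.GL k A)) := fun _ hg =>
  Subgroup.subset_closure (Or.inl (Subgroup.subset_closure (Or.inr (Set.mem_iUnion.2 ⟨α, hg⟩))))

lemma IsAdmissible.aTorusOneParam_subset_G₀ (c : B.cartanLattice) :
    hM.aTorusOneParam 𝒜 c ⊆ (hM.G₀ 𝒜 : Set (hM.GL k A)) := fun _ hg =>
  Subgroup.subset_closure (Or.inr (Subgroup.subset_closure (Or.inl (Set.mem_iUnion.2 ⟨c, hg⟩))))

lemma IsAdmissible.G_eq_sup :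
    hM.G 𝒜 = (hM.G₀ 𝒜 ⊔ Subgroup.closure (⋃ γ, hM.oddOneParam 𝒜 γ) : Subgroup (hM.GL k A)) := by
  rw [G, Subgroup.closure_union, Subgroup.closure_eq]

variable [GradedAlgebra 𝒜]

theorem IsAdmissible.infinitesimals_subset_G₀ :
    infinitesimals k (evenOperators B ρ M) (𝒜 0) ⊆ (hM.G₀ 𝒜 : Set (hM.GL k A)) := by
  rintro g ⟨f, ⟨x, ⟨α, hα, rfl⟩ | ⟨γ, hγ, rfl⟩, hf⟩, d, hd, hdd, hg⟩
  · refine hM.evenOneParam_subset_G₀ ⟨α, hα⟩ ⟨d, hd, ?_⟩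
    rw [hg, hf.ext (hM.actsAs_divPowAct_one ⟨α, hα⟩)]
    exact (finsum_tensorOp_of_sq_eq_zero (hM.divPowAct_zero ⟨α, hα⟩) hdd).symm
  · refine hM.aTorusOneParam_subset_G₀ ⟨_, coroot_mem_cartanLattice B (Or.inr hγ)⟩
      ⟨tangentPoint d hd hdd, fun μ z hz m hm => ?_⟩
    have hfm : f m = (⟨z, adjoinZ_le_Za z.2⟩ : Za a) • m := Subtype.ext <| by
      rw [hf m, hm, hz]; rfl
    rw [tangentPoint_pow, hg, LinearMap.add_apply, Module.End.one_apply, tensorOp_tmul, one_mul,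
      hfm, tmul_smul, ← algebraMap_smul k, add_tmul, smul_tmul]

lemma IsAdmissible.G₀_le_normalizer (h𝒜 : IsSupercommutative 𝒜) (hsq : ∀ x ∈ 𝒜 1, x * x = 0)
    (hρ : IsRational B ρ) :
    hM.G₀ 𝒜 ≤ Subgroup.normalizer
      (Subgroup.closure (⋃ γ, hM.oddOneParam 𝒜 γ) : Set (hM.GL k A)) := by
  have htorus := Set.iUnion_subset (hM.torusOneParam_subset_normalizer h𝒜 hρ)
  have hatorus := Set.iUnion_subset (hM.aTorusOneParam_subset_normalizer h𝒜 hρ)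
  have heven : ⋃ α, hM.evenOneParam 𝒜 α ⊆ (Subgroup.normalizer
      (Subgroup.closure (⋃ γ, hM.oddOneParam 𝒜 γ) : Set (hM.GL k A)) : Set (hM.GL k A)) :=
    Set.iUnion_subset fun α => by
      simpa using hM.evenOneParam_subset_normalizer h𝒜 hsq (α := α) (P := Set.univ) (by simp)
  refine (Subgroup.closure_le _).2 (Set.union_subset ?_ ?_) <;>
    refine (Subgroup.closure_le _).2 (Set.union_subset ?_ ?_)
  exacts [htorus, heven, hatorus, (Subgroup.closure_le _).2 htorus]

section
variable (h𝒜 : IsSupercommutative 𝒜) (hsq : ∀ x ∈ 𝒜 1, x * x = 0)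
include h𝒜 hsq

theorem IsAdmissible.coe_G_eq_G₀_mul_G₁ (hρ : IsRational B ρ) :
    (hM.G 𝒜 : Set (hM.GL k A)) = (hM.G₀ 𝒜 : Set (hM.GL k A)) * hM.G₁ 𝒜 := by
  rw [hM.G_eq_sup, hM.G₁_eq_closure]
  exact Subgroup.coe_mul_of_left_le_normalizer_right _ _ (hM.G₀_le_normalizer h𝒜 hsq hρ)

theorem IsAdmissible.coe_G_eq_G₁_mul_G₀ (hρ : IsRational B ρ) :
    (hM.G 𝒜 : Set (hM.GL k A)) = hM.G₁ 𝒜 * (hM.G₀ 𝒜 : Set (hM.GL k A)) := by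
  rw [hM.G_eq_sup, hM.G₁_eq_closure, sup_comm]
  exact Subgroup.coe_mul_of_right_le_normalizer_left _ _ (hM.G₀_le_normalizer h𝒜 hsq hρ)

lemma IsAdmissible.G₀pm_mul_comm (s : ℤˣ) :
    (hM.G₀pm 𝒜 s * hM.G₁pm 𝒜 s : Set (hM.GL k A)) = hM.G₁pm 𝒜 s * hM.G₀pm 𝒜 s :=
  submonoidClosure_mul_comm (hM.inv_iUnion_oddOneParam_subset _) <|
    Set.iUnion₂_subset fun _ hα => hM.evenOneParam_subset_normalizer h𝒜 hsq
      fun _ _ hγ h => add_mem_oddRoots hα hγ h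

theorem IsAdmissible.Gpm_eq_G₀pm_mul_G₁pm (s : ℤˣ) :
    hM.Gpm 𝒜 s = (hM.G₀pm 𝒜 s * hM.G₁pm 𝒜 s : Set (hM.GL k A)) := by
  rw [Gpm, Submonoid.closure_union]
  exact coe_submonoid_sup_of_mul_comm (hM.G₀pm_mul_comm h𝒜 hsq s)

theorem IsAdmissible.G₀_mul_G₁_eq (e : Fin 8 ≃ roots₁) :
    (hM.G₀ 𝒜 : Set (hM.GL k A)) * hM.G₁ 𝒜 = (hM.G₀ 𝒜 : Set (hM.GL k A)) * hM.G₁ord 𝒜 e := by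
  rw [hM.G₁ord_eq_orderedProd, hM.G₁_eq_closure, hM.closure_iUnion_oddOneParam]
  exact hM.isOddSystem.mul_oddClosure_eq h𝒜 hsq hM.infinitesimals_subset_G₀
    fun γ => (List.mem_ofFn' _ _).2 (e.surjective γ)

theorem IsAdmissible.G₁_mul_G₀_eq (e : Fin 8 ≃ roots₁) :
    hM.G₁ 𝒜 * (hM.G₀ 𝒜 : Set (hM.GL k A)) = hM.G₁ord 𝒜 e * (hM.G₀ 𝒜 : Set (hM.GL k A)) := by
  rw [hM.G₁ord_eq_orderedProd, hM.G₁_eq_closure, hM.closure_iUnion_oddOneParam]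
  exact hM.isOddSystem.oddClosure_mul_eq h𝒜 hsq hM.infinitesimals_subset_G₀
    fun γ => (List.mem_ofFn' _ _).2 (e.surjective γ)

end

end Factorization

end SuperD21

end

theorem mainTheorem7_general {K : Type*} [Field K] [CharZero K] {a : K} (B : ChevalleyBasis a)
    {V : Type*} [AddCommGroup V] [Module K V]
    {ρ : SuperRep K (D21 K a) V} (hρ : IsRational B ρ)
    {M : Submodule (Za a) V} (hM : IsAdmissible B ρ M)
    {k : Type*} [CommRing k] [Algebra (Za a) k]
    {A : Type*} [Ring A] [Algebra k A] (𝒜 : ZMod 2 → Submodule k A) [GradedAlgebra 𝒜]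
    (h𝒜 : IsSupercommutative 𝒜) (hsq : ∀ x ∈ 𝒜 1, x * x = 0) :
    ((hM.G 𝒜 : Set (hM.GL k A)) = (hM.G₀ 𝒜 : Set (hM.GL k A)) * hM.G₁ 𝒜 ∧
      (hM.G 𝒜 : Set (hM.GL k A)) = hM.G₁ 𝒜 * (hM.G₀ 𝒜 : Set (hM.GL k A))) ∧
    (∀ s : ℤˣ, hM.Gpm 𝒜 s = hM.G₀pm 𝒜 s * hM.G₁pm 𝒜 s ∧
      hM.Gpm 𝒜 s = hM.G₁pm 𝒜 s * hM.G₀pm 𝒜 s) ∧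
    (∀ e : Fin 8 ≃ roots₁,
      (hM.G 𝒜 : Set (hM.GL k A)) = (hM.G₀ 𝒜 : Set (hM.GL k A)) * hM.G₁ord 𝒜 e ∧
      (hM.G 𝒜 : Set (hM.GL k A)) = hM.G₁ord 𝒜 e * (hM.G₀ 𝒜 : Set (hM.GL k A))) := by
  have ha := hM.coe_G_eq_G₀_mul_G₁ h𝒜 hsq hρ
  have ha' := hM.coe_G_eq_G₁_mul_G₀ h𝒜 hsq hρ
  have hb (s : ℤˣ) := hM.Gpm_eq_G₀pm_mul_G₁pm h𝒜 hsq s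
  exact ⟨⟨ha, ha'⟩, fun s => ⟨hb s, (hb s).trans (hM.G₀pm_mul_comm h𝒜 hsq s)⟩,
    fun e => ⟨ha.trans (hM.G₀_mul_G₁_eq h𝒜 hsq e), ha'.trans (hM.G₁_mul_G₀_eq h𝒜 hsq e)⟩⟩

theorem mainTheorem7 {K : Type*} [Field K] [IsAlgClosed K] [CharZero K]
    {a : K} (ha0 : a ≠ 0) (ha1 : a ≠ -1) (B : ChevalleyBasis a)
    {V : Type*} [AddCommGroup V] [Module K V] [FiniteDimensional K V]
    {ρ : SuperRep K (D21 K a) V} (hρ : IsRational B ρ)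
    {M : Submodule (Za a) V} (hM : IsAdmissible B ρ M)
    {k : Type*} [CommRing k] [Algebra (Za a) k]
    (hk2 : (2 : k) ≠ 0 ∧ (2 : k) ∈ nonZeroDivisors k)
    (hk3 : (3 : k) ≠ 0 ∧ (3 : k) ∈ nonZeroDivisors k)
    {A : Type*} [Ring A] [Algebra k A] (𝒜 : ZMod 2 → Submodule k A) [GradedAlgebra 𝒜]
    (h𝒜 : IsSupercommutative 𝒜)
    (hA2 : ∀ x : A, 2 * x = 0 → x = 0) (hA3 : ∀ x : A, 3 * x = 0 → x = 0) :
    ((hM.G 𝒜 : Set (hM.GL k A)) = (hM.G₀ 𝒜 : Set (hM.GL k A)) * hM.G₁ 𝒜 ∧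
      (hM.G 𝒜 : Set (hM.GL k A)) = hM.G₁ 𝒜 * (hM.G₀ 𝒜 : Set (hM.GL k A))) ∧
    (∀ s : ℤˣ, hM.Gpm 𝒜 s = hM.G₀pm 𝒜 s * hM.G₁pm 𝒜 s ∧
      hM.Gpm 𝒜 s = hM.G₁pm 𝒜 s * hM.G₀pm 𝒜 s) ∧
    (∀ e : Fin 8 ≃ roots₁,
      (hM.G 𝒜 : Set (hM.GL k A)) = (hM.G₀ 𝒜 : Set (hM.GL k A)) * hM.G₁ord 𝒜 e ∧
      (hM.G 𝒜 : Set (hM.GL k A)) = hM.G₁ord 𝒜 e * (hM.G₀ 𝒜 : Set (hM.GL k A))) :=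
  mainTheorem7_general B hρ hM 𝒜 h𝒜 fun _ => mul_self_eq_zero_of_mem_odd h𝒜 hA2
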